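/- Fix integers $E\ge 5$ and $M$ with $3\le M\le 2^{E-1}$. Let $\mathfrak e_{\min}=-2^{E-1}+2$, $\mathfrak e_{\max}=2^{E-1}-1$, let $\mathbb F=\{(-1)^b\,(s_0.s_1\dots s_M)_2\,2^e : b,s_i\in\{0,1\},\ e\in\{\mathfrak e_{\min},\dots,\mathfrak e_{\max}\}\}\subset\mathbb R$ be the set of finite floats, and let $\overline{\mathbb F}=\mathbb F\cup\{-\infty,+\infty,\mathrm{NaN}\}$. Let $\oplus,\otimes:\overline{\mathbb F}\times\overline{\mathbb F}\to\overline{\mathbb F}$ be IEEE-754 addition and multiplication, rounded to nearest with ties to even (with overflow to $\pm\infty$; the result is $\mathrm{NaN}$ exactly if an operand is $\mathrm{NaN}$, for $(+\infty)\oplus(-\infty)$, and for $0\otimes(\pm\infty)$, in either order). Abstract intervals are $\langle a,b\rangle$ with $a\le b$ in $\mathbb F\cup\{\pm\infty\}$, and $\top$; their concretizations are $\gamma(\langle a,b\rangle)=[a,b]\cap\overline{\mathbb F}$ and $\gamma(\top)=\overline{\mathbb F}$; an abstract box $\mathcal B=(\mathcal I_1,\dots,\mathcal I_n)$ has $\gamma(\mathcal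 B)=\prod_i\gamma(\mathcal I_i)$, and is said to be in $\mathbb F^n$ if $\gamma(\mathcal B)\subseteq\mathbb F^n$. For $\odot\in\{\oplus,\otimes\}$ put $\mathcal I\odot^\sharp\mathcal J=\langle\min S,\max S\rangle$ if $\mathrm{NaN}\notin S$ and $\mathcal I\odot^\sharp\mathcal J=\top$ otherwise, where $S=\{x\odot y: x\in\gamma(\mathcal I),\,y\in\gamma(\mathcal J)\}$. A straight-line program $Q$ with $n$ inputs and $m$ outputs is a finite sequence of assignments, each of which stores in a new register a constant $c\in\mathbb F$ or the result of $\oplus$ or $\otimes$ on two earlier registers (input registers included), together with a choice of $m$ output registers. Its interval semantics $Q^\sharp$ executes the same assignments on abstract intervals, with $\langle c,c\rangle$ for $c$ and $\oplus^\sharp,\otimes^\sharp$ for $\oplus,\otimes$. Theorem. The class of straight-line programs that use only $\oplus$, $\otimes$ and floating-point constants is floating-point interval-complete: for all integers $n,m\ge1$ and every function $P:\mathbb F^n\to(\mathbb F\cup\{-\infty,+\infty\})^m$ there is such a straight-line program $Q$, which returns no $\mathrm{NaN}$ on inputs from $\mathbb F^n$, that interval-simulates $P$: for every abstract box $\mathcal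 B$ in $\mathbb F^n$, $$\gamma\big(Q^\sharp(\mathcal B)\big)=\prod_{j=1}^m\Big(\big[\min P_j(\gamma(\mathcal B)),\ \max P_j(\gamma(\mathcal B))\big]\cap\overline{\mathbb F}\Big),$$ where $P_j$ is the $j$-th component of $P$ (for $m=1$ this is $\gamma(Q^\sharp(\mathcal B))=[\min P(\gamma(\mathcal B)),\max P(\gamma(\mathcal B))]\cap\overline{\mathbb F}$). -/

import Mathlib

noncomputable section

namespace FloatIA

/-! ### Finite floats -/

/-- The smallest exponent `-2^(E-1) + 2`. -/
def emin (E : ℕ) : ℤ := -2 ^ (E - 1) + 2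

/-- The largest exponent `2^(E-1) - 1`. -/
def emax (E : ℕ) : ℤ := 2 ^ (E - 1) - 1

/-- `x` is a finite float with `E`-bit exponent and `(M+1)`-bit significand, that is,
`x = ± (s₀.s₁…s_M)₂ × 2^e` with `emin ≤ e ≤ emax`. The signed significand is written as
`k × 2^(-M)`, where `k` is an integer whose absolute value has at most `M+1` binary digits. -/
def IsFinite (E M : ℕ) (x : ℝ) : Prop :=
  ∃ k e : ℤ, |k| < 2 ^ (M + 1) ∧ emin E ≤ e ∧ e ≤ emax E ∧ x = (k : ℝ) * (2 : ℝ) ^ (e - M)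

/-- The set `𝔽` of finite floats (with a single zero), with the order of the reals. -/
abbrev Fin𝔽 (E M : ℕ) : Type := {x : ℝ // IsFinite E M x}

/-- The linearly ordered set `𝔽 ∪ {-∞, +∞}`; `⊥` is `-∞` and `⊤` is `+∞`. -/
abbrev Ext𝔽 (E M : ℕ) : Type := WithBot (WithTop (Fin𝔽 E M))

/-- The set of all floats, `𝔽 ∪ {-∞, +∞, NaN}`. -/
inductive Float𝔽 (E M : ℕ) : Type
  | num (v : Ext𝔽 E M) : Float𝔽 E M
  | nan : Float𝔽 E M

/-- A finite float as an element of `𝔽 ∪ {-∞, +∞}`. -/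
def Fin𝔽.toExt {E M : ℕ} (x : Fin𝔽 E M) : Ext𝔽 E M := ((x : WithTop (Fin𝔽 E M)) : Ext𝔽 E M)

/-- A finite float as a float. -/
def Fin𝔽.toFloat {E M : ℕ} (x : Fin𝔽 E M) : Float𝔽 E M := Float𝔽.num x.toExt

/-- The value of an element of `𝔽 ∪ {-∞, +∞}` as an extended real. -/
def Ext𝔽.toEReal {E M : ℕ} (v : Ext𝔽 E M) : EReal :=
  WithBot.map (WithTop.map (fun x : Fin𝔽 E M => (x : ℝ))) v

/-! ### Rounding to nearest, ties to even -/

/-- The exponent `max {⌊log₂ |x|⌋, emin}` of a real number; it is `emin` at `0`. -/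
def expo (E : ℕ) (x : ℝ) : ℤ := if x = 0 then emin E else max (Int.log 2 |x|) (emin E)

/-- The last digit (number `M`) of the significand `|x| / 2^(expo x)` is zero. -/
def LastDigitZero (E M : ℕ) (x : ℝ) : Prop :=
  ∃ j : ℤ, x = ((2 * j : ℤ) : ℝ) * (2 : ℝ) ^ (expo E x - M)

/-- `y` is the finite float nearest to `x`, a tie being broken by the zero last digit. -/
def IsNearestEven {E M : ℕ} (x : ℝ) (y : Fin𝔽 E M) : Prop :=
  (∀ z : Fin𝔽 E M, |(y : ℝ) - x| ≤ |(z : ℝ) - x|) ∧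
    ((∃ z : Fin𝔽 E M, z ≠ y ∧ |(z : ℝ) - x| = |(y : ℝ) - x|) → LastDigitZero E M y)

theorem isFinite_zero {E M : ℕ} (hE : 2 ≤ E) : IsFinite E M 0 := by
  refine ⟨0, emin E, by positivity, le_rfl, ?_, by simp⟩
  have : (2:ℤ) ^ 1 ≤ 2 ^ (E - 1) := pow_le_pow_right₀ (by norm_num) (by omega)
  unfold emin emax; omega

theorem isFinite_neg {E M : ℕ} {x : ℝ} (h : IsFinite E M x) : IsFinite E M (-x) := by
  obtain ⟨k, e, h1, h2, h3, rfl⟩ := h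
  exact ⟨-k, e, by simpa using h1, h2, h3, by push_cast; ring⟩

theorem finite_isFinite (E M : ℕ) : {x : ℝ | IsFinite E M x}.Finite := by
  have hf : (Set.Icc (-2 ^ (M + 1) : ℤ) (2 ^ (M + 1)) ×ˢ Set.Icc (emin E) (emax E)).Finite :=
    (Set.finite_Icc _ _).prod (Set.finite_Icc _ _)
  refine (hf.image (fun p : ℤ × ℤ => (p.1 : ℝ) * (2 : ℝ) ^ (p.2 - M))).subset ?_
  rintro x ⟨k, e, h1, h2, h3, rfl⟩
  have := abs_lt.mp h1
  exact ⟨(k, e), ⟨⟨this.1.le, this.2.le⟩, h2, h3⟩, rfl⟩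

instance (E M : ℕ) : Finite (Fin𝔽 E M) := finite_isFinite E M

/-- The representation of a non-negative finite float with exponent `expo`. -/
theorem canonical {E M : ℕ} {x : ℝ} (h : IsFinite E M x) (hx : 0 ≤ x) (hE : 2 ≤ E) :
    ∃ k : ℤ, 0 ≤ k ∧ k < 2 ^ (M + 1) ∧ expo E x ≤ emax E ∧ x = (k : ℝ) * (2 : ℝ) ^ (expo E x - M) := by
  have hee : emin E ≤ emax E := by
    have : (2:ℤ) ^ 1 ≤ 2 ^ (E - 1) := pow_le_pow_right₀ (by norm_num) (by omega)
    unfold emin emax; omega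
  rcases hx.eq_or_lt with rfl | hx
  · exact ⟨0, le_rfl, by positivity, by simpa [expo] using hee, by simp⟩
  obtain ⟨k, e, h1, h2, h3, hxe⟩ := h
  have h2pos : ∀ a : ℤ, (0 : ℝ) < (2 : ℝ) ^ a := fun a => by positivity
  have hk : 0 < k := by
    by_contra hk
    have : (k : ℝ) ≤ 0 := by exact_mod_cast not_lt.mp hk
    nlinarith [h2pos (e - M)]
  have hle : expo E x ≤ e := by
    rw [expo, if_neg hx.ne', abs_of_pos hx]
    refine max_le ?_ h2
    suffices Int.log 2 x < e + 1 by omega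
    rw [← Int.lt_zpow_iff_log_lt (by norm_num) hx, hxe]
    have : (k : ℝ) < 2 ^ (M + 1) := by exact_mod_cast (le_abs_self k).trans_lt h1
    calc (k : ℝ) * (2 : ℝ) ^ (e - M) < 2 ^ (M + 1) * (2 : ℝ) ^ (e - M) := by gcongr
      _ = _ := by
        rw [← zpow_natCast, ← zpow_add₀ (by norm_num)]
        push_cast; congr 1; ring
  have hx' : x = ((k * 2 ^ (e - expo E x).toNat : ℤ) : ℝ) * (2 : ℝ) ^ (expo E x - M) := by
    push_cast
    rw [mul_assoc, ← zpow_natCast, ← zpow_add₀ (by norm_num), Int.toNat_of_nonneg (by omega)]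
    conv_lhs => rw [hxe]
    congr 2; ring
  refine ⟨_, by positivity, ?_, hle.trans h3, hx'⟩
  have hlt : x < (2 : ℝ) ^ (expo E x + 1) := by
    refine (Int.lt_zpow_succ_log_self (b := 2) (by norm_num) x).trans_le ?_
    rw [expo, if_neg hx.ne', abs_of_pos hx]
    exact_mod_cast zpow_le_zpow_right₀ (a := (2:ℝ)) (by norm_num) (by simp)
  set K := k * 2 ^ (e - expo E x).toNat
  have : (K : ℝ) * (2 : ℝ) ^ (expo E x - M) < 2 ^ (M + 1) * (2 : ℝ) ^ (expo E x - M) := by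
    rw [← hx']
    refine hlt.trans_le (le_of_eq ?_)
    rw [← zpow_natCast, ← zpow_add₀ (by norm_num)]
    push_cast; congr 1; ring
  exact_mod_cast lt_of_mul_lt_mul_right this (h2pos _).le

theorem expo_neg (E : ℕ) (x : ℝ) : expo E (-x) = expo E x := by simp [expo]

theorem emin_le_expo (E : ℕ) (x : ℝ) : emin E ≤ expo E x := by
  unfold expo; split_ifs <;> simp

theorem expo_mono {E : ℕ} {x y : ℝ} (hx : 0 ≤ x) (h : x ≤ y) : expo E x ≤ expo E y := by
  rcases hx.eq_or_lt with rfl | hx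
  · simpa [expo] using emin_le_expo E y
  · have hy := hx.trans_le h
    simp only [expo, if_neg hx.ne', if_neg hy.ne', abs_of_pos hx, abs_of_pos hy]
    exact max_le_max (Int.log_mono_right hx h) le_rfl

theorem lastDigitZero_neg {E M : ℕ} {x : ℝ} : LastDigitZero E M (-x) ↔ LastDigitZero E M x := by
  unfold LastDigitZero
  rw [expo_neg]
  constructor <;> rintro ⟨j, hj⟩ <;> refine ⟨-j, ?_⟩ <;> push_cast at hj ⊢ <;> linarith

theorem lastDigitZero_iff {E M : ℕ} {x : ℝ} {k : ℤ}
    (h : x = (k : ℝ) * (2 : ℝ) ^ (expo E x - M)) : LastDigitZero E M x ↔ Even k := by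
  have h2 : (2 : ℝ) ^ (expo E x - M) ≠ 0 := by positivity
  constructor
  · rintro ⟨j, hj⟩
    have : (k : ℝ) = ((2 * j : ℤ) : ℝ) := mul_right_cancel₀ h2 (h.symm.trans hj)
    exact ⟨j, by rw [← two_mul]; exact_mod_cast this⟩
  · rintro ⟨j, rfl⟩
    exact ⟨j, by rw [two_mul]; exact h⟩

/-- Of two adjacent non-negative finite floats exactly one has a zero last digit. -/
theorem adjacent_nonneg {E M : ℕ} (hE : 2 ≤ E) (hM : 1 ≤ M) {y z : ℝ} (hy : IsFinite E M y)
    (hz : IsFinite E M z) (h0 : 0 ≤ y) (hyz : y < z)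
    (hadj : ∀ w, IsFinite E M w → w ≤ y ∨ z ≤ w) :
    LastDigitZero E M z ↔ ¬ LastDigitZero E M y := by
  obtain ⟨k, hk0, hk, he, hyk⟩ := canonical hy h0 hE
  obtain ⟨l, hl0, hl, he', hzl⟩ := canonical hz (h0.trans hyz.le) hE
  rw [lastDigitZero_iff hyk]
  have h2pos : ∀ a : ℤ, (0 : ℝ) < (2 : ℝ) ^ a := fun a => by positivity
  have hemin := emin_le_expo E y
  have hmono := expo_mono (E := E) h0 hyz.le
  set e := expo E y with hedef
  set e₂ := expo E z with he2def
  have hpow : (2 : ℝ) ^ (e + 1) = ((2 ^ (M + 1) : ℤ) : ℝ) * (2 : ℝ) ^ (e - M) := by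
    push_cast
    rw [← zpow_natCast, ← zpow_add₀ (by norm_num)]
    push_cast; congr 1; ring
  have hzL : z = ((l * 2 ^ (e₂ - e).toNat : ℤ) : ℝ) * (2 : ℝ) ^ (e - M) := by
    push_cast
    rw [mul_assoc, ← zpow_natCast, ← zpow_add₀ (by norm_num), Int.toNat_of_nonneg (by omega)]
    conv_lhs => rw [hzl]
    congr 2; ring
  have hge : k + 1 ≤ l * 2 ^ (e₂ - e).toNat := by
    have : (k : ℝ) * (2 : ℝ) ^ (e - M) <
        ((l * 2 ^ (e₂ - e).toNat : ℤ) : ℝ) * (2 : ℝ) ^ (e - M) := by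
      rw [← hzL, ← hyk]; exact hyz
    have := lt_of_mul_lt_mul_right this (h2pos _).le
    have : k < l * 2 ^ (e₂ - e).toNat := by exact_mod_cast this
    omega
  have hzge : ((k + 1 : ℤ) : ℝ) * (2 : ℝ) ^ (e - M) ≤ z := by
    rw [hzL]
    exact mul_le_mul_of_nonneg_right (by exact_mod_cast hge) (h2pos _).le
  have hfin : IsFinite E M (((k + 1 : ℤ) : ℝ) * (2 : ℝ) ^ (e - M)) := by
    rcases (show k + 1 ≤ 2 ^ (M + 1) by omega).lt_or_eq with h | h
    · exact ⟨k + 1, e, by rwa [abs_of_nonneg (by omega)], hemin, he, rfl⟩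
    · refine ⟨2 ^ M, e + 1, ?_, by omega, ?_, ?_⟩
      · rw [abs_of_nonneg (by positivity)]
        exact pow_lt_pow_right₀ (by norm_num) (by omega)
      · by_contra hcon
        have : e₂ = e := by omega
        rw [this] at hge
        simp at hge
        omega
      · rw [h, ← hpow]; push_cast
        rw [← zpow_natCast, ← zpow_add₀ (by norm_num)]
        congr 1; ring
  have hzeq : z = ((k + 1 : ℤ) : ℝ) * (2 : ℝ) ^ (e - M) := by
    refine le_antisymm ((hadj _ hfin).resolve_left (not_le.mpr ?_)) hzge
    rw [hyk]
    refine mul_lt_mul_of_pos_right ?_ (h2pos _)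
    push_cast; linarith
  have hz0 : 0 < z := h0.trans_lt hyz
  rcases (show k + 1 ≤ 2 ^ (M + 1) by omega).lt_or_eq with h | h
  · have : e₂ = e := by
      refine le_antisymm ?_ hmono
      rw [he2def, expo, if_neg hz0.ne', abs_of_pos hz0]
      refine max_le ?_ hemin
      suffices Int.log 2 z < e + 1 by omega
      rw [← Int.lt_zpow_iff_log_lt (by norm_num) hz0, hzeq]
      push_cast
      rw [show ((2 : ℝ) ^ (e + 1)) = _ from hpow]
      exact mul_lt_mul_of_pos_right (by exact_mod_cast h) (h2pos _)
    rw [lastDigitZero_iff (k := k + 1) (by rw [← he2def, this]; exact hzeq)]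
    exact Int.even_add_one
  · have hz2 : z = (2 : ℝ) ^ (e + 1) := by rw [hzeq, h, hpow]
    have : e₂ = e + 1 := by
      have hlog := Int.log_zpow (R := ℝ) (b := 2) (by norm_num) (e + 1)
      rw [he2def, expo, if_neg hz0.ne', abs_of_pos hz0, hz2]
      push_cast at hlog
      rw [hlog]
      exact max_eq_left (by omega)
    rw [lastDigitZero_iff (k := 2 ^ M) (by
      rw [← he2def, this, hz2]; push_cast
      rw [← zpow_natCast, ← zpow_add₀ (by norm_num)]
      congr 1; ring)]
    have h1 : Even ((2 : ℤ) ^ M) := (even_two).pow_of_ne_zero (by omega)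
    have h2 : Even ((2 : ℤ) ^ (M + 1)) := (even_two).pow_of_ne_zero (by omega)
    rw [← h, Int.even_add_one] at h2
    exact iff_of_true h1 h2

/-- Of two adjacent finite floats exactly one has a zero last digit. -/
theorem adjacent {E M : ℕ} (hE : 2 ≤ E) (hM : 1 ≤ M) {y z : ℝ} (hy : IsFinite E M y)
    (hz : IsFinite E M z) (hyz : y < z) (hadj : ∀ w, IsFinite E M w → w ≤ y ∨ z ≤ w) :
    LastDigitZero E M z ↔ ¬ LastDigitZero E M y := by
  rcases le_or_gt 0 y with h | h
  · exact adjacent_nonneg hE hM hy hz h hyz hadj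
  · have hz0 : z ≤ 0 := (hadj 0 (isFinite_zero hE)).resolve_left (not_le.mpr h)
    have := adjacent_nonneg hE hM (isFinite_neg hz) (isFinite_neg hy) (by linarith)
      (neg_lt_neg hyz) (fun w hw => by
        rcases hadj (-w) (isFinite_neg hw) with h | h
        · right; linarith
        · left; linarith)
    rw [lastDigitZero_neg, lastDigitZero_neg] at this
    tauto

/-- Rounding to nearest, ties to even, is well defined. -/
theorem existsUnique_isNearestEven {E M : ℕ} (hE : 2 ≤ E) (hM : 1 ≤ M) (x : ℝ) :
    ∃! y : Fin𝔽 E M, IsNearestEven x y := by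
  have : Nonempty (Fin𝔽 E M) := ⟨⟨0, isFinite_zero hE⟩⟩
  have key : ∀ y z : Fin𝔽 E M, (∀ w : Fin𝔽 E M, |(y : ℝ) - x| ≤ |(w : ℝ) - x|) → y < z →
      |(z : ℝ) - x| = |(y : ℝ) - x| →
      (LastDigitZero E M z ↔ ¬ LastDigitZero E M y) ∧
        ∀ w : Fin𝔽 E M, |(w : ℝ) - x| = |(y : ℝ) - x| → w = y ∨ w = z := by
    intro y z hmin hyz heq
    have hyz' : (y : ℝ) < z := hyz
    have hmid : (y : ℝ) + z = 2 * x := by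
      rcases abs_eq_abs.mp heq with h | h <;> linarith
    have hd : |(y : ℝ) - x| = (z - y) / 2 := by
      rw [abs_of_nonpos (by linarith)]; linarith
    refine ⟨adjacent hE hM y.2 z.2 hyz' fun w hw => ?_, fun w hw => ?_⟩
    · have := hmin ⟨w, hw⟩
      rw [hd] at this
      rcases le_abs.mp this with h | h <;> simp only at h
      · right; linarith
      · left; linarith
    · rw [hd] at hw
      rcases (abs_eq (by linarith)).mp hw with h | h
      · right; exact Subtype.ext (by linarith)
      · left; exact Subtype.ext (by linarith)
  obtain ⟨y, hmin⟩ := Finite.exists_min (fun y : Fin𝔽 E M => |(y : ℝ) - x|)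
  by_cases htie : ∃ z, z ≠ y ∧ |(z : ℝ) - x| = |(y : ℝ) - x|
  · obtain ⟨a, b, hab, hamin, hbeq⟩ : ∃ a b : Fin𝔽 E M, a < b ∧
        (∀ w : Fin𝔽 E M, |(a : ℝ) - x| ≤ |(w : ℝ) - x|) ∧ |(b : ℝ) - x| = |(a : ℝ) - x| := by
      obtain ⟨z, hne, hz⟩ := htie
      rcases hne.lt_or_gt with h | h
      · exact ⟨z, y, h, fun w => hz ▸ hmin w, hz.symm⟩
      · exact ⟨y, z, h, hmin, hz⟩
    obtain ⟨hpar, honly⟩ := key a b hamin hab hbeq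
    have hmem : ∀ w : Fin𝔽 E M, IsNearestEven x w → w = a ∨ w = b := fun w hw =>
      honly w (le_antisymm (hw.1 a) (hamin w))
    have hta : IsNearestEven x a → LastDigitZero E M a := fun h => h.2 ⟨b, hab.ne', hbeq⟩
    have htb : IsNearestEven x b → LastDigitZero E M b := fun h => h.2 ⟨a, hab.ne, hbeq.symm⟩
    by_cases hla : LastDigitZero E M a
    · refine ⟨a, ⟨hamin, fun _ => hla⟩, fun w hw => ?_⟩
      rcases hmem w hw with rfl | rfl
      · rfl
      · exact absurd hla (hpar.mp (htb hw))
    · refine ⟨b, ⟨fun w => hbeq ▸ hamin w, fun _ => hpar.mpr hla⟩, fun w hw => ?_⟩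
      rcases hmem w hw with rfl | rfl
      · exact absurd (hta hw) hla
      · rfl
  · refine ⟨y, ⟨hmin, fun h => absurd h htie⟩, fun w hw => ?_⟩
    by_contra hne
    exact htie ⟨w, hne, le_antisymm (hw.1 y) (hmin w)⟩

/-- The largest finite float `Ω = 2^emax (2 - 2^(-M))`. -/
def maxFloat (E M : ℕ) : ℝ := (2 : ℝ) ^ emax E * (2 - (2 : ℝ) ^ (-(M : ℤ)))

/-- The overflow threshold `Ω + c` with `c = 2^emax ε` and `ε = 2^(-M-1)`. -/
def overflow (E M : ℕ) : ℝ := maxFloat E M + (2 : ℝ) ^ emax E * (2 : ℝ) ^ (-(M : ℤ) - 1)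

open Classical in
/-- The finite float nearest to a real number. The fallback value is never taken, and the chosen
float is unique: see `existsUnique_isNearestEven`. -/
def nearest (E M : ℕ) (x : ℝ) : Ext𝔽 E M :=
  if h : ∃ y : Fin𝔽 E M, IsNearestEven x y then (Classical.choose h).toExt else ⊥

open Classical in
/-- The rounding function on the extended reals. -/
def rnd (E M : ℕ) (x : EReal) : Ext𝔽 E M :=
  if x ≤ ((-overflow E M : ℝ) : EReal) then ⊥
  else if ((overflow E M : ℝ) : EReal) ≤ x then ⊤
  else nearest E M x.toReal

/-! ### Floating-point addition and multiplication (IEEE-754) -/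

open Classical in
/-- `x ⊕ y`: the rounded sum; `NaN` if an operand is `NaN` or for `(+∞) + (-∞)`. -/
def Float𝔽.add {E M : ℕ} : Float𝔽 E M → Float𝔽 E M → Float𝔽 E M
  | .num x, .num y =>
    if (x = ⊤ ∧ y = ⊥) ∨ (x = ⊥ ∧ y = ⊤) then .nan
    else .num (rnd E M (Ext𝔽.toEReal x + Ext𝔽.toEReal y))
  | _, _ => .nan

open Classical in
/-- `x ⊗ y`: the rounded product; `NaN` if an operand is `NaN` or for `0 × (±∞)`. -/
def Float𝔽.mul {E M : ℕ} : Float𝔽 E M → Float𝔽 E M → Float𝔽 E M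
  | .num x, .num y =>
    if (Ext𝔽.toEReal x = 0 ∧ (y = ⊤ ∨ y = ⊥)) ∨ ((x = ⊤ ∨ x = ⊥) ∧ Ext𝔽.toEReal y = 0) then .nan
    else .num (rnd E M (Ext𝔽.toEReal x * Ext𝔽.toEReal y))
  | _, _ => .nan

/-! ### The interval domain -/

/-- Abstract intervals: `⟨a, b⟩` with `a ≤ b` in `𝔽 ∪ {-∞, +∞}`, and `top`. -/
inductive AbsInterval (E M : ℕ) : Type
  | mk (a b : Ext𝔽 E M) (h : a ≤ b) : AbsInterval E M
  | top : AbsInterval E M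

/-- Concretization of an abstract interval: `top` stands for all floats including `NaN`. -/
def AbsInterval.conc {E M : ℕ} : AbsInterval E M → Set (Float𝔽 E M)
  | .mk a b _ => {y | ∃ v, y = .num v ∧ a ≤ v ∧ v ≤ b}
  | .top => Set.univ

/-- Concretization of an abstract box. -/
def boxConc {E M d : ℕ} (B : Fin d → AbsInterval E M) : Set (Fin d → Float𝔽 E M) :=
  {y | ∀ i, y i ∈ (B i).conc}

/-- The abstract box is in `𝔽^d`. -/
def BoxFinite {E M d : ℕ} (B : Fin d → AbsInterval E M) : Prop :=
  boxConc B ⊆ {y | ∃ x : Fin d → Fin𝔽 E M, y = fun i => (x i).toFloat}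

/-- The non-`NaN` part of a set of floats. -/
def numPart {E M : ℕ} (S : Set (Float𝔽 E M)) : Set (Ext𝔽 E M) := {v | Float𝔽.num v ∈ S}

/-- Each non-empty set of elements of `𝔽 ∪ {-∞, +∞}` has a minimum and a maximum. -/
theorem exists_min_max {E M : ℕ} (S : Set (Ext𝔽 E M)) (h : S.Nonempty) :
    ∃ p : Ext𝔽 E M × Ext𝔽 E M, IsLeast S p.1 ∧ IsGreatest S p.2 := by
  have : Finite (Ext𝔽 E M) := inferInstanceAs (Finite (Option (Option (Fin𝔽 E M))))
  obtain ⟨a, ha⟩ := S.toFinite.exists_minimal h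
  obtain ⟨b, hb⟩ := S.toFinite.exists_maximal h
  refine ⟨(a, b), ⟨ha.1, fun y hy => ?_⟩, ⟨hb.1, fun y hy => ?_⟩⟩
  · exact (le_total a y).elim id (fun h => ha.2 hy h)
  · exact (le_total y b).elim id (fun h => hb.2 hy h)

open Classical in
/-- The abstraction of a non-empty set `S` of floats: `⟨min S, max S⟩` if `NaN ∉ S`, and `top`
if `NaN ∈ S`. Minimum and maximum exist for each non-empty `S` without `NaN`:
see `exists_min_max`. -/
def hull {E M : ℕ} (S : Set (Float𝔽 E M)) : AbsInterval E M :=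
  if h : Float𝔽.nan ∉ S ∧
      ∃ p : Ext𝔽 E M × Ext𝔽 E M, IsLeast (numPart S) p.1 ∧ IsGreatest (numPart S) p.2 then
    .mk (Classical.choose h.2).1 (Classical.choose h.2).2
      ((Classical.choose_spec h.2).1.2 (Classical.choose_spec h.2).2.1)
  else .top

/-- The interval operation of a binary operation on floats: the abstraction of its image. -/
def sharp {E M : ℕ} (op : Float𝔽 E M → Float𝔽 E M → Float𝔽 E M) (I J : AbsInterval E M) :
    AbsInterval E M :=
  hull (Set.image2 op I.conc J.conc)

/-! ### Straight-line programs over `⊕`, `⊗` and constants -/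

/-- An instruction that may read `k` registers: load a finite float constant, or apply `⊕` or `⊗`
to the contents of two registers. -/
inductive Instr (E M k : ℕ) : Type
  | const (c : Fin𝔽 E M) : Instr E M k
  | add (i j : Fin k) : Instr E M k
  | mul (i j : Fin k) : Instr E M k

/-- `Code E M n k`: a finite sequence of instructions that starts with the `n` input registers and
ends with `k` registers; each instruction writes its result to a new register, the next one. -/
inductive Code (E M n : ℕ) : ℕ → Type
  | nil : Code E M n n
  | snoc {k : ℕ} (p : Code E M n k) (i : Instr E M k) : Code E M n (k + 1)

/-- Execution of an instruction over a domain `α` of values. -/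
def Instr.exec {E M k : ℕ} {α : Type} (cst : Fin𝔽 E M → α) (add mul : α → α → α)
    (r : Fin k → α) : Instr E M k → α
  | .const c => cst c
  | .add i j => add (r i) (r j)
  | .mul i j => mul (r i) (r j)

/-- Contents of the registers after execution on the input `x`. -/
def Code.run {E M n : ℕ} {α : Type} (cst : Fin𝔽 E M → α) (add mul : α → α → α) (x : Fin n → α) :
    {k : ℕ} → Code E M n k → (Fin k → α)
  | _, .nil => x
  | _, .snoc p i =>
    Fin.snoc (α := fun _ => α) (p.run cst add mul x) (i.exec cst add mul (p.run cst add mul x))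

/-- A straight-line program with `n` inputs and `m` outputs: a code and its output registers. -/
structure Prog (E M n m : ℕ) : Type where
  size : ℕ
  code : Code E M n size
  out : Fin m → Fin size

/-- The concrete (floating-point) semantics of a straight-line program. -/
def Prog.eval {E M n m : ℕ} (Q : Prog E M n m) (x : Fin n → Float𝔽 E M) : Fin m → Float𝔽 E M :=
  fun j => Q.code.run Fin𝔽.toFloat Float𝔽.add Float𝔽.mul x (Q.out j)

/-- The interval semantics of a straight-line program: a constant `c` becomes `⟨c, c⟩`, and the
operations become the interval operations. -/
def Prog.intervalEval {E M n m : ℕ} (Q : Prog E M n m) (B : Fin n → AbsInterval E M) :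
    Fin m → AbsInterval E M :=
  fun j => Q.code.run (fun c => AbsInterval.mk c.toExt c.toExt le_rfl)
    (sharp Float𝔽.add) (sharp Float𝔽.mul) B (Q.out j)

/-- On finite floats, the program returns finite or infinite floats (never `NaN`). -/
def Prog.NaNFree {E M n m : ℕ} (Q : Prog E M n m) : Prop :=
  ∀ x : Fin n → Fin𝔽 E M, ∀ j, Q.eval (fun i => (x i).toFloat) j ≠ Float𝔽.nan

/-- The image under the `j`-th component of `P` of the points of an abstract box in `𝔽^n`. -/
def imageOn {E M n m : ℕ} (P : (Fin n → Fin𝔽 E M) → (Fin m → Ext𝔽 E M))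
    (B : Fin n → AbsInterval E M) (j : Fin m) : Set (Ext𝔽 E M) :=
  {v | ∃ x : Fin n → Fin𝔽 E M, (fun i => (x i).toFloat) ∈ boxConc B ∧ P x j = v}

/-- `Q` interval-simulates `P`: for every abstract box `B` in `𝔽^n`, the concretization of
`Q♯(B)` is the box of all floats between `min P(γ(B))` and `max P(γ(B))`, coordinatewise. -/
def IntervalSimulates {E M n m : ℕ} (Q : Prog E M n m)
    (P : (Fin n → Fin𝔽 E M) → (Fin m → Ext𝔽 E M)) : Prop :=
  ∀ B : Fin n → AbsInterval E M, BoxFinite B →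
    ∃ lo hi : Fin m → Ext𝔽 E M,
      (∀ j, IsLeast (imageOn P B j) (lo j)) ∧ (∀ j, IsGreatest (imageOn P B j) (hi j)) ∧
      boxConc (Q.intervalEval B) =
        {y | ∀ j, ∃ v, y j = Float𝔽.num v ∧ lo j ≤ v ∧ v ≤ hi j}

end FloatIA

end

/-!
The programs below apply `-1 ⊗ x` to inputs only, and otherwise just sums and products with
non-negative constants, which are monotone; so the interval semantics evaluates them at the two end
points of the ranges of the `x i` and the `-x i`. The only dependence that could cause a loss of
precision is that between `x i` and `-x i`; it is dealt with under *Sets*. It remains to realize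
enough functions in this way without an overflow to `±∞`, which could never be undone.

*Thresholds.* Multiplication by `5 / 8`, rounded, fixes `0` and the smallest positive float `tiny`
and strictly decreases every larger float (`lt_of_rnd_five_eighths`, `rnd_five_eighths_tiny`). Hence
an iterate of it is the sign function with values `-tiny, 0, tiny` (`realizes_sgn`). Applied to a
difference `x - c`, or to `x / 2 - c / 2` if `c` is large, and once more after adding `tiny`, it
gives the indicator function of `c ≤ x` with values `0` and `tiny` (`realizes_threshold`).
Disjunction and conjunction are thresholds of a sum of two such values.

*Sets.* The conjunction of the conditions `c i ≤ x i` and `x i ≤ d i` has, on a box `[a, b]`, the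
minimum `tiny` (true) exactly if `[a, b]` is contained in `[c, d]` and the maximum `tiny` exactly if
`[a, b]` meets `[c, d]`. The indicator function of an arbitrary set `S` is the disjunction of these
over all boxes contained in `S`. Its interval evaluation is exact because a box contained in `S` is
one of these boxes (`decides_set`).

*Values.* Apply this to the superlevel sets of a component of `P`. Going through the floats in
increasing order `u < v < ...`, the function `min P v` is `min P u` plus `v - u` times the indicator
function of `v ≤ P`. These sums are exact since the difference of adjacent floats is a float. The
values `±∞` arise by an overflow in the first and in the last sum (`computes_of_decides`).

Programs arise from expression trees (`exists_prog`), and the absence of `NaN` follows from the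
soundness of the interval semantics (`Prog.eval_mem`).
-/

namespace FloatIA

variable {E M n : ℕ}

/-! ### Rounding -/

/-- The parameters for which the theorem holds. -/
structure Admissible (E M : ℕ) : Prop where
  five_le : 5 ≤ E
  three_le : 3 ≤ M
  le_pow : M ≤ 2 ^ (E - 1)

theorem Admissible.two_le (h : Admissible E M) : 2 ≤ E := by have := h.five_le; omega

theorem Admissible.one_le (h : Admissible E M) : 1 ≤ M := by have := h.three_le; omega

theorem Admissible.emin_le (h : Admissible E M) : emin E ≤ -14 := by
  have : (2 : ℤ) ^ 4 ≤ 2 ^ (E - 1) :=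
    pow_le_pow_right₀ (by norm_num) (by have := h.five_le; omega)
  unfold emin; omega

theorem emax_eq (E : ℕ) : emax E = 1 - emin E := by unfold emin emax; ring

theorem Admissible.le_emax (h : Admissible E M) : (M : ℤ) ≤ emax E + 1 := by
  have := h.le_pow
  have : (M : ℤ) ≤ 2 ^ (E - 1) := by exact_mod_cast this
  unfold emax; omega

theorem IsFinite.zpow (h : Admissible E M) {j : ℤ} (h1 : emin E - M ≤ j) (h2 : j ≤ emax E) :
    IsFinite E M (2 ^ j) := by
  have := h.emin_le
  have := emax_eq E
  rcases le_total (j + M) (emax E) with h | h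
  · exact ⟨1, j + M, by
      rw [abs_one]; exact one_lt_pow₀ (by norm_num) (by omega), by omega, h, by simp⟩
  · refine ⟨2 ^ (j + M - emax E).toNat, emax E, ?_, ?_, le_rfl, ?_⟩
    · rw [abs_of_nonneg (by positivity)]
      exact pow_lt_pow_right₀ (by norm_num) (by omega)
    · omega
    · push_cast
      rw [← zpow_natCast, ← zpow_add₀ (by norm_num), Int.toNat_of_nonneg (by omega)]
      congr 1; ring

theorem abs_le_maxFloat (x : Fin𝔽 E M) : |(x : ℝ)| ≤ maxFloat E M := by
  obtain ⟨x, k, e, h1, h2, h3, rfl⟩ := x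
  have hk : (|k| : ℝ) ≤ 2 ^ (M + 1) - 1 := by exact_mod_cast Int.le_sub_one_of_lt h1
  have hM : maxFloat E M = (2 ^ (M + 1) - 1) * (2 : ℝ) ^ (emax E - M) := by
    rw [maxFloat, zpow_sub₀ (by norm_num), zpow_neg, zpow_natCast]
    field_simp
    ring
  rw [hM, abs_mul, abs_of_pos (a := (2 : ℝ) ^ (e - M)) (by positivity)]
  have : (2 : ℝ) ^ (e - M) ≤ (2 : ℝ) ^ (emax E - M) :=
    zpow_le_zpow_right₀ (by norm_num) (by omega)
  have h0 : (0 : ℝ) ≤ |(k : ℝ)| := abs_nonneg _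
  gcongr
  linarith

theorem isFinite_maxFloat (h : Admissible E M) : IsFinite E M (maxFloat E M) := by
  have := h.emin_le
  have := emax_eq E
  refine ⟨2 ^ (M + 1) - 1, emax E, ?_, by omega, le_rfl, ?_⟩
  · have : (1 : ℤ) ≤ 2 ^ (M + 1) := one_le_pow₀ (by norm_num)
    rw [abs_of_nonneg (by omega)]
    omega
  · rw [maxFloat, zpow_sub₀ (by norm_num), zpow_neg, zpow_natCast]
    push_cast
    field_simp
    ring

theorem overflow_eq : overflow E M = maxFloat E M + 2 ^ (emax E - M - 1) := by
  rw [overflow, ← zpow_add₀ (by norm_num)]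
  congr 2; ring

theorem maxFloat_lt_overflow : maxFloat E M < overflow E M := by
  rw [overflow_eq]; have : (0 : ℝ) < 2 ^ (emax E - M - 1) := by positivity
  linarith

theorem nearest_eq (h : Admissible E M) {x : ℝ} {y : Fin𝔽 E M} (hy : IsNearestEven x y) :
    nearest E M x = y.toExt := by
  have hex : ∃ y : Fin𝔽 E M, IsNearestEven x y := ⟨y, hy⟩
  rw [nearest, dif_pos hex]
  congr 1
  exact (existsUnique_isNearestEven h.two_le h.one_le x).unique (Classical.choose_spec hex) hy

theorem Fin𝔽.toExt_le {x y : Fin𝔽 E M} : x.toExt ≤ y.toExt ↔ (x : ℝ) ≤ y := by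
  simp only [Fin𝔽.toExt, WithBot.coe_le_coe, WithTop.coe_le_coe, Subtype.coe_le_coe]

theorem Fin𝔽.toExt_inj {x y : Fin𝔽 E M} : x.toExt = y.toExt ↔ x = y := by
  simp only [Fin𝔽.toExt, WithBot.coe_inj, WithTop.coe_inj]

theorem IsNearestEven.mono (h : Admissible E M) {r s : ℝ} {y z : Fin𝔽 E M}
    (hy : IsNearestEven r y) (hz : IsNearestEven s z) (hrs : r ≤ s) : (y : ℝ) ≤ z := by
  by_contra! hlt
  have h1 := hy.1 z
  have h2 := hz.1 y
  have hr : (y : ℝ) + z ≤ 2 * r := by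
    by_contra! hc
    rw [← sq_le_sq] at h1
    nlinarith
  have hs : 2 * s ≤ (y : ℝ) + z := by
    by_contra! hc
    rw [← sq_le_sq] at h2
    nlinarith
  obtain rfl : r = s := by linarith
  exact hlt.ne' (congrArg _ ((existsUnique_isNearestEven h.two_le h.one_le r).unique hy hz))

theorem rnd_mono (h : Admissible E M) : Monotone (rnd E M) := by
  intro x y hxy
  unfold rnd
  split_ifs with h1 h2 h3 h4 h5 h6 h7
  all_goals first
    | exact bot_le
    | exact le_top
    | exact absurd (hxy.trans ‹_›) ‹_›
    | exact absurd (le_trans ‹_› hxy) ‹_›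
    | skip
  have hx := not_le.mp h1
  have hy := not_le.mp ‹¬ (overflow E M : EReal) ≤ y›
  lift x to ℝ using ⟨ne_top_of_lt (hxy.trans_lt hy), ne_bot_of_gt hx⟩
  lift y to ℝ using ⟨ne_top_of_lt hy, ne_bot_of_gt (hx.trans_le hxy)⟩
  obtain ⟨u, hu, -⟩ := existsUnique_isNearestEven h.two_le h.one_le x
  obtain ⟨v, hv, -⟩ := existsUnique_isNearestEven h.two_le h.one_le y
  rw [EReal.toReal_coe, EReal.toReal_coe, nearest_eq h hu, nearest_eq h hv, Fin𝔽.toExt_le]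
  exact hu.mono h hv (EReal.coe_le_coe_iff.mp hxy)

theorem rnd_eq_of_isNearestEven (h : Admissible E M) {r : ℝ} {y : Fin𝔽 E M}
    (hr : |r| < overflow E M) (hy : IsNearestEven r y) : rnd E M r = y.toExt := by
  have := abs_lt.mp hr
  rw [rnd, if_neg (by rw [EReal.coe_le_coe_iff]; linarith),
    if_neg (by rw [EReal.coe_le_coe_iff]; linarith), EReal.toReal_coe, nearest_eq h hy]

theorem exists_rnd_eq (h : Admissible E M) {r : ℝ} (hr : |r| < overflow E M) :
    ∃ y : Fin𝔽 E M, rnd E M r = y.toExt := by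
  obtain ⟨y, hy, -⟩ := existsUnique_isNearestEven h.two_le h.one_le r
  exact ⟨y, rnd_eq_of_isNearestEven h hr hy⟩

/-- A float that is strictly closer to `r` than all others is the rounding of `r`. -/
theorem rnd_eq_of_forall_lt (h : Admissible E M) {r : ℝ} {y : Fin𝔽 E M}
    (hr : |r| < overflow E M) (hy : ∀ z : Fin𝔽 E M, z ≠ y → |(y : ℝ) - r| < |(z : ℝ) - r|) :
    rnd E M r = y.toExt := by
  refine rnd_eq_of_isNearestEven h hr ⟨fun z => ?_, ?_⟩
  · rcases eq_or_ne z y with rfl | hz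
    · exact le_rfl
    · exact (hy z hz).le
  · rintro ⟨z, hz, heq⟩
    exact absurd heq (hy z hz).ne'

theorem rnd_coe (h : Admissible E M) (x : Fin𝔽 E M) : rnd E M ((x : ℝ) : EReal) = x.toExt := by
  refine rnd_eq_of_forall_lt h ((abs_le_maxFloat x).trans_lt maxFloat_lt_overflow) fun z hz => ?_
  rw [sub_self, abs_zero, abs_pos, sub_ne_zero]
  exact fun hc => hz (Subtype.ext hc)

theorem rnd_eq_of_eq (h : Admissible E M) {r : ℝ} {x : Fin𝔽 E M} (hx : r = x) :
    rnd E M r = x.toExt := hx ▸ rnd_coe h x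

/-- Rounding does not cross a float. -/
theorem le_of_rnd (h : Admissible E M) {r : ℝ} {x y : Fin𝔽 E M} (hr : rnd E M r = y.toExt)
    (hx : r ≤ x) : (y : ℝ) ≤ x := by
  rw [← Fin𝔽.toExt_le, ← hr, ← rnd_coe h]
  exact rnd_mono h (EReal.coe_le_coe_iff.mpr hx)

theorem ge_of_rnd (h : Admissible E M) {r : ℝ} {x y : Fin𝔽 E M} (hr : rnd E M r = y.toExt)
    (hx : (x : ℝ) ≤ r) : (x : ℝ) ≤ y := by
  rw [← Fin𝔽.toExt_le, ← hr, ← rnd_coe h]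
  exact rnd_mono h (EReal.coe_le_coe_iff.mpr hx)

theorem IsNearestEven.neg {r : ℝ} {y : Fin𝔽 E M} (hy : IsNearestEven r y) :
    IsNearestEven (-r) (⟨-y, isFinite_neg y.2⟩ : Fin𝔽 E M) := by
  have key : ∀ z : ℝ, |-z - r| = |z - -r| := fun z => by
    rw [← abs_neg]; congr 1; ring
  refine ⟨fun z => ?_, ?_⟩
  · have := hy.1 ⟨-z, isFinite_neg z.2⟩
    rw [key] at this
    rwa [← key, neg_neg]
  · rintro ⟨z, hz, heq⟩
    refine lastDigitZero_neg.mpr (hy.2 ⟨⟨-z, isFinite_neg z.2⟩, fun hc => hz ?_, ?_⟩)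
    · exact Subtype.ext (by rw [← hc]; simp)
    · rw [key, heq, ← key, neg_neg]

theorem rnd_neg (h : Admissible E M) {r : ℝ} {y : Fin𝔽 E M} (hr : |r| < overflow E M)
    (hy : rnd E M r = y.toExt) :
    rnd E M ((-r : ℝ) : EReal) = Fin𝔽.toExt ⟨-y, isFinite_neg y.2⟩ := by
  obtain ⟨z, hz, -⟩ := existsUnique_isNearestEven h.two_le h.one_le r
  have := rnd_eq_of_isNearestEven h hr hz
  rw [hy, Fin𝔽.toExt_inj] at this
  subst this
  exact rnd_eq_of_isNearestEven h (by rwa [abs_neg]) hz.neg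

/-! ### The smallest positive float -/

/-- The smallest positive float `2 ^ (emin - M)`. -/
noncomputable def tiny (h : Admissible E M) : Fin𝔽 E M :=
  ⟨2 ^ (emin E - M), .zpow h le_rfl (by have := h.emin_le; have := emax_eq E; omega)⟩

/-- The float `0`. -/
noncomputable def zero (h : Admissible E M) : Fin𝔽 E M := ⟨0, isFinite_zero h.two_le⟩

@[simp] theorem coe_zero (h : Admissible E M) : (zero h : ℝ) = 0 := rfl

theorem tiny_pos (h : Admissible E M) : (0 : ℝ) < tiny h := by
  change (0 : ℝ) < 2 ^ (emin E - M); positivity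

theorem exists_eq_mul_tiny (h : Admissible E M) (x : Fin𝔽 E M) : ∃ k : ℤ, (x : ℝ) = k * tiny h := by
  obtain ⟨x, k, e, h1, h2, h3, rfl⟩ := x
  refine ⟨k * 2 ^ (e - emin E).toNat, ?_⟩
  change (k : ℝ) * 2 ^ (e - M) = _ * 2 ^ (emin E - M)
  push_cast
  rw [mul_assoc, ← zpow_natCast, ← zpow_add₀ (by norm_num), Int.toNat_of_nonneg (by omega)]
  congr 2; ring

theorem tiny_le_sub (h : Admissible E M) {x y : Fin𝔽 E M} (hxy : (x : ℝ) < y) :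
    (tiny h : ℝ) ≤ y - x := by
  obtain ⟨k, hk⟩ := exists_eq_mul_tiny h x
  obtain ⟨l, hl⟩ := exists_eq_mul_tiny h y
  have ht := tiny_pos h
  rw [hk, hl] at hxy ⊢
  have : k < l := by exact_mod_cast lt_of_mul_lt_mul_right hxy ht.le
  have : (k : ℝ) + 1 ≤ l := by exact_mod_cast this
  nlinarith

theorem tiny_le (h : Admissible E M) {x : Fin𝔽 E M} (hx : (0 : ℝ) < x) : (tiny h : ℝ) ≤ x := by
  simpa using tiny_le_sub h (x := zero h) hx

/-- The rounded difference of two floats has the sign of the exact one: there is no underflow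
to `0`. -/
theorem nonneg_of_rnd_sub (h : Admissible E M) {x y z : Fin𝔽 E M}
    (hz : rnd E M (((x : ℝ) - y : ℝ) : EReal) = z.toExt) : (0 : ℝ) ≤ z ↔ (y : ℝ) ≤ x := by
  constructor
  · contrapose!
    intro hxy
    have := tiny_le_sub h hxy
    have := le_of_rnd h (x := ⟨-tiny h, isFinite_neg (tiny h).2⟩) hz
      (by change _ ≤ -(tiny h : ℝ); linarith)
    have : (z : ℝ) ≤ -tiny h := this
    linarith [tiny_pos h]
  · intro hxy
    exact ge_of_rnd h (x := zero h) hz (by simpa using hxy)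

/-! ### Exact interval evaluation of one operation -/

/-- The abstract interval `I` is `⟨p, q⟩`. -/
def AbsInterval.Is (I : AbsInterval E M) (p q : Ext𝔽 E M) : Prop := ∃ h : p ≤ q, I = .mk p q h

theorem hull_is {S : Set (Float𝔽 E M)} {p q : Ext𝔽 E M}
    (hS : ∀ y ∈ S, ∃ v, y = .num v ∧ p ≤ v ∧ v ≤ q) (hp : .num p ∈ S) (hq : .num q ∈ S) :
    (hull S).Is p q := by
  have hnum : ∀ v, Float𝔽.num v ∈ S → p ≤ v ∧ v ≤ q := fun v hv => by
    obtain ⟨w, hw, h⟩ := hS _ hv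
    cases hw
    exact h
  have hl : IsLeast (numPart S) p := ⟨hp, fun v hv => (hnum v hv).1⟩
  have hg : IsGreatest (numPart S) q := ⟨hq, fun v hv => (hnum v hv).2⟩
  have hex : Float𝔽.nan ∉ S ∧
      ∃ p : Ext𝔽 E M × Ext𝔽 E M, IsLeast (numPart S) p.1 ∧ IsGreatest (numPart S) p.2 :=
    ⟨fun hc => (nomatch (hS _ hc).choose_spec.1), (p, q), hl, hg⟩
  have hspec := Classical.choose_spec hex.2
  refine ⟨(hnum p hp).2, ?_⟩
  rw [hull, dif_pos hex]
  congr 1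
  · exact hspec.1.unique hl
  · exact hspec.2.unique hg

theorem Fin𝔽.toEReal_toExt (x : Fin𝔽 E M) : Ext𝔽.toEReal x.toExt = ((x : ℝ) : EReal) := rfl

theorem Ext𝔽.toEReal_mono : Monotone (Ext𝔽.toEReal (E := E) (M := M)) :=
  ((WithTop.monotone_map_iff (f := fun x : Fin𝔽 E M => (x : ℝ))).2 fun _ _ h => h).withBot_map

theorem Fin𝔽.toExt_ne_top (x : Fin𝔽 E M) : x.toExt ≠ ⊤ := by
  rw [Fin𝔽.toExt, ← WithBot.coe_top, Ne, WithBot.coe_inj]; exact WithTop.coe_ne_top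

theorem Fin𝔽.toExt_ne_bot (x : Fin𝔽 E M) : x.toExt ≠ ⊥ := WithBot.coe_ne_bot

theorem add_toExt (v : Ext𝔽 E M) (x : Fin𝔽 E M) :
    Float𝔽.add (.num v) (.num x.toExt) = .num (rnd E M (Ext𝔽.toEReal v + (x : ℝ))) := by
  simp only [Float𝔽.add, x.toExt_ne_top, x.toExt_ne_bot, and_false, or_self, if_false,
    Fin𝔽.toEReal_toExt]

theorem mul_toExt (x y : Fin𝔽 E M) :
    Float𝔽.mul (.num x.toExt) (.num y.toExt) = .num (rnd E M ((x * y : ℝ) : EReal)) := by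
  simp only [Float𝔽.mul, Fin𝔽.toExt_ne_top, Fin𝔽.toExt_ne_bot, and_false, false_and, or_self,
    if_false, Fin𝔽.toEReal_toExt, EReal.coe_mul]

theorem exists_toExt {x y : Fin𝔽 E M} {v : Ext𝔽 E M} (h1 : x.toExt ≤ v) (h2 : v ≤ y.toExt) :
    ∃ z : Fin𝔽 E M, v = z.toExt := by
  induction v using WithBot.recBotCoe with
  | bot => exact absurd (le_bot_iff.mp h1) x.toExt_ne_bot
  | coe v =>
    induction v using WithTop.recTopCoe with
    | top => exact absurd (top_le_iff.mp h2) y.toExt_ne_top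
    | coe v => exact ⟨v, rfl⟩

theorem sharp_add_is (h : Admissible E M) {I J : AbsInterval E M} {p q p' q' : Ext𝔽 E M}
    {x y : Fin𝔽 E M} (hI : I.Is p q) (hJ : J.Is x.toExt y.toExt)
    (hp : rnd E M (Ext𝔽.toEReal p + (x : ℝ)) = p')
    (hq : rnd E M (Ext𝔽.toEReal q + (y : ℝ)) = q') : (sharp Float𝔽.add I J).Is p' q' := by
  obtain ⟨hpq, rfl⟩ := hI
  obtain ⟨hxy, rfl⟩ := hJ
  subst hp hq
  refine hull_is ?_ ⟨_, ⟨p, rfl, le_rfl, hpq⟩, _, ⟨_, rfl, le_rfl, hxy⟩, add_toExt p x⟩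
    ⟨_, ⟨q, rfl, hpq, le_rfl⟩, _, ⟨_, rfl, hxy, le_rfl⟩, add_toExt q y⟩
  rintro _ ⟨_, ⟨v, rfl, hv1, hv2⟩, _, ⟨w, rfl, hw1, hw2⟩, rfl⟩
  obtain ⟨z, rfl⟩ := exists_toExt hw1 hw2
  exact ⟨_, add_toExt v z,
    rnd_mono h (add_le_add (Ext𝔽.toEReal_mono hv1) (Ext𝔽.toEReal_mono hw1)),
    rnd_mono h (add_le_add (Ext𝔽.toEReal_mono hv2) (Ext𝔽.toEReal_mono hw2))⟩

theorem mk_self_is (v : Ext𝔽 E M) : (AbsInterval.mk v v le_rfl).Is v v := ⟨le_rfl, rfl⟩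

theorem sharp_mul_is (h : Admissible E M) {I J : AbsInterval E M} {x y c : Fin𝔽 E M}
    {p' q' : Ext𝔽 E M} (hc : (0 : ℝ) ≤ c) (hI : I.Is x.toExt y.toExt) (hJ : J.Is c.toExt c.toExt)
    (hp : rnd E M ((x * c : ℝ) : EReal) = p') (hq : rnd E M ((y * c : ℝ) : EReal) = q') :
    (sharp Float𝔽.mul I J).Is p' q' := by
  obtain ⟨hxy, rfl⟩ := hI
  obtain ⟨-, rfl⟩ := hJ
  subst hp hq
  refine hull_is ?_ ⟨_, ⟨_, rfl, le_rfl, hxy⟩, _, ⟨_, rfl, le_rfl, le_rfl⟩, mul_toExt x c⟩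
    ⟨_, ⟨_, rfl, hxy, le_rfl⟩, _, ⟨_, rfl, le_rfl, le_rfl⟩, mul_toExt y c⟩
  rintro _ ⟨_, ⟨v, rfl, hv1, hv2⟩, _, ⟨w, rfl, hw1, hw2⟩, rfl⟩
  obtain ⟨z, rfl⟩ := exists_toExt hv1 hv2
  obtain rfl := le_antisymm hw1 hw2
  refine ⟨_, mul_toExt z c, rnd_mono h ?_, rnd_mono h ?_⟩ <;> rw [EReal.coe_le_coe_iff]
  · exact mul_le_mul_of_nonneg_right (Fin𝔽.toExt_le.mp hv1) hc
  · exact mul_le_mul_of_nonneg_right (Fin𝔽.toExt_le.mp hv2) hc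

/-- The negative of a finite float. -/
noncomputable def neg (x : Fin𝔽 E M) : Fin𝔽 E M := ⟨-x, isFinite_neg x.2⟩

@[simp] theorem coe_neg (x : Fin𝔽 E M) : (neg x : ℝ) = -x := rfl

theorem sharp_mul_neg_one_is (h : Admissible E M) {I J : AbsInterval E M} {x y c : Fin𝔽 E M}
    (hc : (c : ℝ) = -1) (hI : I.Is x.toExt y.toExt) (hJ : J.Is c.toExt c.toExt) :
    (sharp Float𝔽.mul I J).Is (neg y).toExt (neg x).toExt := by
  obtain ⟨hxy, rfl⟩ := hI
  obtain ⟨-, rfl⟩ := hJ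
  have key : ∀ z : Fin𝔽 E M, Float𝔽.mul (.num z.toExt) (.num c.toExt) = .num (neg z).toExt :=
    fun z => by rw [mul_toExt, rnd_eq_of_eq h (x := neg z) (by rw [hc]; simp)]
  refine hull_is ?_ ⟨_, ⟨_, rfl, hxy, le_rfl⟩, _, ⟨_, rfl, le_rfl, le_rfl⟩, key y⟩
    ⟨_, ⟨_, rfl, le_rfl, hxy⟩, _, ⟨_, rfl, le_rfl, le_rfl⟩, key x⟩
  rintro _ ⟨_, ⟨v, rfl, hv1, hv2⟩, _, ⟨w, rfl, hw1, hw2⟩, rfl⟩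
  obtain ⟨z, rfl⟩ := exists_toExt hv1 hv2
  obtain rfl := le_antisymm hw1 hw2
  refine ⟨_, key z, ?_, ?_⟩ <;> rw [Fin𝔽.toExt_le] at * <;> simpa

/-! ### Expressions -/

/-- Expression trees over `n` variables, finite constants, `⊕` and `⊗`. -/
inductive Expr (E M n : ℕ) : Type
  | var (i : Fin n) : Expr E M n
  | const (c : Fin𝔽 E M) : Expr E M n
  | add (e f : Expr E M n) : Expr E M n
  | mul (e f : Expr E M n) : Expr E M n

/-- Evaluation of an expression over a domain `α` of values. -/
def Expr.eval {α : Type} (cst : Fin𝔽 E M → α) (add mul : α → α → α) (x : Fin n → α) :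
    Expr E M n → α
  | .var i => x i
  | .const c => cst c
  | .add e f => add (e.eval cst add mul x) (f.eval cst add mul x)
  | .mul e f => mul (e.eval cst add mul x) (f.eval cst add mul x)

/-- The interval semantics of an expression. -/
noncomputable def Expr.ieval (e : Expr E M n) (B : Fin n → AbsInterval E M) : AbsInterval E M :=
  e.eval (fun c => AbsInterval.mk c.toExt c.toExt le_rfl) (sharp Float𝔽.add) (sharp Float𝔽.mul) B

/-- The function `g` can be applied to an arbitrary expression by means of `⊕`, `⊗` and constants
in such a way that the interval semantics applies `g` to both end points. -/
def Realizes (n : ℕ) (g : Fin𝔽 E M → Fin𝔽 E M) : Prop :=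
  ∃ G : Expr E M n → Expr E M n, ∀ e B x y, (e.ieval B).Is x.toExt y.toExt →
    ((G e).ieval B).Is (g x).toExt (g y).toExt

theorem Realizes.id : Realizes n (id : Fin𝔽 E M → Fin𝔽 E M) := ⟨_root_.id, fun _ _ _ _ h => h⟩

theorem Realizes.comp {f g : Fin𝔽 E M → Fin𝔽 E M} (hf : Realizes n f) (hg : Realizes n g) :
    Realizes n (f ∘ g) := by
  obtain ⟨F, hF⟩ := hf
  obtain ⟨G, hG⟩ := hg
  exact ⟨F ∘ G, fun e B x y h => hF _ _ _ _ (hG _ _ _ _ h)⟩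

theorem Realizes.iterate {f : Fin𝔽 E M → Fin𝔽 E M} (hf : Realizes n f) (N : ℕ) :
    Realizes n f^[N] := by
  induction N with
  | zero => exact .id
  | succ N ih => rw [Function.iterate_succ']; exact hf.comp ih

theorem Realizes.add_const (h : Admissible E M) {g : Fin𝔽 E M → Fin𝔽 E M} (c : Fin𝔽 E M)
    (hg : ∀ x : Fin𝔽 E M, rnd E M ((x + c : ℝ) : EReal) = (g x).toExt) : Realizes n g :=
  ⟨fun e => .add e (.const c), fun _ _ x y hxy =>
    sharp_add_is h hxy (mk_self_is _) (hg x) (hg y)⟩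

theorem Realizes.mul_const (h : Admissible E M) {g : Fin𝔽 E M → Fin𝔽 E M} (c : Fin𝔽 E M)
    (hc : (0 : ℝ) ≤ c) (hg : ∀ x : Fin𝔽 E M, rnd E M ((x * c : ℝ) : EReal) = (g x).toExt) :
    Realizes n g :=
  ⟨fun e => .mul e (.const c), fun _ _ x y hxy =>
    sharp_mul_is h hc hxy (mk_self_is _) (hg x) (hg y)⟩

/-! ### The sign function -/

theorem abs_mul_lt_overflow {c : ℝ} (hc0 : 0 ≤ c) (hc1 : c ≤ 1) (x : Fin𝔽 E M) :
    |(x : ℝ) * c| < overflow E M := by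
  refine lt_of_le_of_lt ?_ ((abs_le_maxFloat x).trans_lt maxFloat_lt_overflow)
  rw [abs_mul, abs_of_nonneg hc0]
  exact mul_le_of_le_one_right (abs_nonneg _) hc1

/-- The rounding of `5 x / 8` is smaller than `x`, for each float `x` above the smallest positive
one. -/
theorem lt_of_rnd_five_eighths (h : Admissible E M) {x y : Fin𝔽 E M} (hx : (tiny h : ℝ) < x)
    (hy : rnd E M ((x * (5 / 8) : ℝ) : EReal) = y.toExt) : (y : ℝ) < x := by
  have hx0 := (tiny_pos h).trans hx
  refine lt_of_le_of_ne (le_of_rnd h hy (by linarith)) fun heq => ?_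
  -- It suffices to find a float in `(x / 4, x)`, which is closer to `5 x / 8` than `x` is.
  obtain ⟨z, hz1, hz2⟩ : ∃ z : Fin𝔽 E M, (x : ℝ) / 4 < z ∧ (z : ℝ) < x := by
    obtain ⟨x, k, e, h1, h2, h3, rfl⟩ := x
    have hp : (0 : ℝ) < 2 ^ (e - M) := by positivity
    change (0 : ℝ) < k * 2 ^ (e - M) at hx0
    change (2 : ℝ) ^ (emin E - M) < k * 2 ^ (e - M) at hx
    have hk : 0 < k := by exact_mod_cast (pos_iff_pos_of_mul_pos hx0).mpr hp
    rcases eq_or_lt_of_le (Int.add_one_le_iff.mpr hk) with hk1 | hk2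
    · obtain rfl : k = 1 := by omega
      rw [Int.cast_one, one_mul, zpow_lt_zpow_iff_right₀ (by norm_num)] at hx
      refine ⟨⟨_, .zpow h (j := e - M - 1) (by omega) (by omega)⟩, ?_⟩
      change _ < (2 : ℝ) ^ (e - M - 1) ∧ (2 : ℝ) ^ (e - M - 1) < _
      rw [zpow_sub_one₀ (by norm_num)]
      constructor <;> simp only [Int.cast_one] <;> linarith
    · refine ⟨⟨_, k - 1, e, ?_, h2, h3, rfl⟩, ?_⟩
      · rw [abs_of_pos (by omega)]; rw [abs_of_pos hk] at h1; omega
      · have : (2 : ℝ) ≤ k := by exact_mod_cast (show 2 ≤ k by omega)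
        change _ < ((k - 1 : ℤ) : ℝ) * 2 ^ (e - M) ∧ ((k - 1 : ℤ) : ℝ) * 2 ^ (e - M) < _
        push_cast
        constructor <;> nlinarith
  have hov : |(x : ℝ) * (5 / 8)| < overflow E M :=
    abs_mul_lt_overflow (by norm_num) (by norm_num) x
  obtain ⟨w, hw, -⟩ := existsUnique_isNearestEven h.two_le h.one_le ((x : ℝ) * (5 / 8))
  rw [rnd_eq_of_isNearestEven h hov hw, Fin𝔽.toExt_inj] at hy
  subst hy
  have := hw.1 z
  rw [heq, ← sq_le_sq] at this
  nlinarith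

theorem rnd_five_eighths_tiny (h : Admissible E M) :
    rnd E M ((tiny h * (5 / 8) : ℝ) : EReal) = (tiny h).toExt := by
  refine rnd_eq_of_forall_lt h (abs_mul_lt_overflow (by norm_num) (by norm_num) _) fun z hz => ?_
  have ht := tiny_pos h
  rw [← sq_lt_sq]
  rcases lt_or_gt_of_ne (show (z : ℝ) ≠ tiny h from fun hc => hz (Subtype.ext hc)) with hlt | hlt
  · have := tiny_le_sub h hlt
    nlinarith
  · have := tiny_le_sub h hlt
    nlinarith

open Classical in
/-- The sign of `x`, multiplied by the smallest positive float. -/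
noncomputable def sgn (h : Admissible E M) (x : Fin𝔽 E M) : Fin𝔽 E M :=
  if (0 : ℝ) < x then tiny h else if (x : ℝ) < 0 then neg (tiny h) else zero h

theorem sgn_of_pos (h : Admissible E M) {x : Fin𝔽 E M} (hx : (0 : ℝ) < x) : sgn h x = tiny h :=
  if_pos hx

theorem sgn_of_neg (h : Admissible E M) {x : Fin𝔽 E M} (hx : (x : ℝ) < 0) :
    sgn h x = neg (tiny h) := by
  rw [sgn, if_neg hx.not_gt, if_pos hx]

theorem sgn_of_eq_zero (h : Admissible E M) {x : Fin𝔽 E M} (hx : (x : ℝ) = 0) :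
    sgn h x = zero h := by
  rw [sgn, if_neg hx.not_gt, if_neg hx.not_lt]

/-- The sign function is an iterate of the multiplication by `5 / 8`: as `5 / 8 > 1 / 2`, the
smallest positive float is rounded back to itself, and as `5 / 8 < 3 / 4`, no other positive float
is. -/
theorem realizes_sgn (h : Admissible E M) : Realizes n (sgn h) := by
  have hfin : IsFinite E M (5 / 8) := by
    have := h.emin_le
    have := h.le_emax
    have := emax_eq E
    refine ⟨5, M - 3, ?_, by omega, by omega, ?_⟩
    · have : (2 : ℤ) ^ 4 ≤ 2 ^ (M + 1) :=
        pow_le_pow_right₀ (by norm_num) (by have := h.three_le; omega)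
      norm_num at this ⊢; omega
    · rw [show (M : ℤ) - 3 - M = -3 by ring]; norm_num
  choose f hf using fun x : Fin𝔽 E M =>
    exists_rnd_eq h (abs_mul_lt_overflow (c := 5 / 8) (by norm_num) (by norm_num) x)
  have hneg : ∀ x, f (neg x) = neg (f x) := fun x => by
    rw [← Fin𝔽.toExt_inj, ← hf, coe_neg, neg_mul]
    exact rnd_neg h (abs_mul_lt_overflow (by norm_num) (by norm_num) x) (hf x)
  have hzero : f (zero h) = zero h := by
    rw [← Fin𝔽.toExt_inj, ← hf]
    exact rnd_eq_of_eq h (by simp)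
  have htiny : f (tiny h) = tiny h := by
    rw [← Fin𝔽.toExt_inj, ← hf, rnd_five_eighths_tiny]
  have hpos : ∀ x : Fin𝔽 E M, (0 : ℝ) < x → ∃ N, ∀ m, N ≤ m → f^[m] x = tiny h := by
    intro x
    induction x using WellFoundedLT.induction with
    | ind x ih =>
      intro hx
      rcases (tiny_le h hx).eq_or_lt with heq | hlt
      · obtain rfl : tiny h = x := Subtype.ext heq
        exact ⟨0, fun m _ => Function.iterate_fixed htiny m⟩
      · have hfx : (tiny h : ℝ) ≤ f x := by
          refine le_trans (le_of_eq ?_) (?_ : (f (tiny h) : ℝ) ≤ f x)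
          · rw [htiny]
          · rw [← Fin𝔽.toExt_le, ← hf, ← hf]
            refine rnd_mono h (EReal.coe_le_coe_iff.mpr ?_)
            linarith
        obtain ⟨N, hN⟩ := ih (f x) (lt_of_rnd_five_eighths h hlt (hf x))
          ((tiny_pos h).trans_le hfx)
        refine ⟨N + 1, fun m hm => ?_⟩
        obtain ⟨m, rfl⟩ : ∃ k, m = k + 1 := ⟨m - 1, by omega⟩
        rw [Function.iterate_succ_apply]
        exact hN m (by omega)
  have hall : ∀ x : Fin𝔽 E M, ∃ N, ∀ m, N ≤ m → f^[m] x = sgn h x := by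
    intro x
    rcases lt_trichotomy (x : ℝ) 0 with hx | hx | hx
    · obtain ⟨N, hN⟩ := hpos (neg x) (by simpa using hx)
      refine ⟨N, fun m hm => ?_⟩
      have hsemi : f^[m] (neg x) = neg (f^[m] x) :=
        Function.Commute.iterate_left hneg m x
      rw [sgn_of_neg h hx, ← hN m hm, hsemi]
      exact Subtype.ext (by simp)
    · obtain rfl : x = zero h := Subtype.ext hx
      exact ⟨0, fun m _ => by rw [sgn_of_eq_zero h hx, Function.iterate_fixed hzero]⟩
    · rw [sgn_of_pos h hx]
      exact hpos x hx
  choose N hN using hall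
  obtain ⟨K, hK⟩ := (Set.finite_range N).bddAbove
  have hK : f^[K] = sgn h := funext fun x => hN x K (hK ⟨x, rfl⟩)
  rw [← hK]
  exact (Realizes.mul_const h ⟨5 / 8, hfin⟩ (by norm_num) hf).iterate K

/-! ### Threshold functions -/

open Classical in
/-- The float `x` if `s` holds, and `0` otherwise. -/
noncomputable def select (h : Admissible E M) (s : Prop) (x : Fin𝔽 E M) : Fin𝔽 E M :=
  if s then x else zero h

theorem select_of_true (h : Admissible E M) {s : Prop} (hs : s) (x : Fin𝔽 E M) :
    select h s x = x := if_pos hs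

theorem select_of_false (h : Admissible E M) {s : Prop} (hs : ¬ s) (x : Fin𝔽 E M) :
    select h s x = zero h := if_neg hs

/-- The truth value of `s`, encoded by `0` and the smallest positive float. -/
noncomputable def truth (h : Admissible E M) (s : Prop) : Fin𝔽 E M := select h s (tiny h)

theorem truth_of_true (h : Admissible E M) {s : Prop} (hs : s) : truth h s = tiny h := if_pos hs

theorem truth_of_false (h : Admissible E M) {s : Prop} (hs : ¬ s) : truth h s = zero h := if_neg hs

theorem add_lt_overflow {c : ℝ} (hc : |c| < 2 ^ (emax E - M - 1)) (x : Fin𝔽 E M) :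
    |(x : ℝ) + c| < overflow E M := by
  rw [overflow_eq]
  exact (abs_add_le _ _).trans_lt (add_lt_add_of_le_of_lt (abs_le_maxFloat x) hc)

theorem tiny_lt_zpow (h : Admissible E M) : |(tiny h : ℝ)| < 2 ^ (emax E - M - 1) := by
  rw [abs_of_pos (tiny_pos h)]
  have := h.emin_le
  have := emax_eq E
  exact zpow_lt_zpow_right₀ (by norm_num) (by omega)

/-- Division by `2` is exact above the smallest binade. -/
theorem IsFinite.half {x : ℝ} (hx : IsFinite E M x)
    (hle : 2 ^ (emin E + 1) ≤ |x|) : IsFinite E M (x / 2) := by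
  obtain ⟨k, e, h1, h2, h3, rfl⟩ := hx
  rcases h2.eq_or_lt with rfl | h2
  · have : |(k : ℝ)| < 2 ^ (M + 1) := by exact_mod_cast h1
    rw [abs_mul, abs_of_pos (a := (2 : ℝ) ^ (emin E - M)) (by positivity)] at hle
    have h4 : (2 : ℝ) ^ (emin E + 1) = 2 ^ (M + 1) * 2 ^ (emin E - M) := by
      rw [← zpow_natCast, ← zpow_add₀ (by norm_num)]
      congr 1; push_cast; ring
    rw [h4] at hle
    exact absurd (le_of_mul_le_mul_right hle (by positivity)) (not_le.mpr this)
  · refine ⟨k, e - 1, h1, by omega, by omega, ?_⟩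
    rw [show e - 1 - M = e - M - 1 by ring, zpow_sub_one₀ (by norm_num)]
    ring

/-- Each threshold can be moved to `0` without overflow: by a subtraction if the threshold is small,
and by a subtraction after a division by `2` if it is large. -/
theorem exists_realizes_nonneg_iff (h : Admissible E M) (c : Fin𝔽 E M) :
    ∃ g : Fin𝔽 E M → Fin𝔽 E M, Realizes n g ∧ ∀ x, (0 : ℝ) ≤ g x ↔ c ≤ x := by
  rcases lt_or_ge |(c : ℝ)| (2 ^ (emax E - M - 1)) with hc | hc
  · choose g hg using fun x : Fin𝔽 E M =>
      exists_rnd_eq h (add_lt_overflow (c := -c) (by rwa [abs_neg]) x)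
    exact ⟨g, .add_const h (neg c) hg, fun x =>
      nonneg_of_rnd_sub h (x := x) (y := c) (by rw [sub_eq_add_neg, hg])⟩
  have hmin := h.emin_le
  have hmax := h.le_emax
  have hmm := emax_eq E
  have hc2 : (2 : ℝ) ^ (emin E + 2) ≤ |(c : ℝ)| :=
    (zpow_le_zpow_right₀ (by norm_num) (by omega)).trans hc
  have hpow : (2 : ℝ) ^ (emin E + 2) = 2 * 2 ^ (emin E + 1) := by
    rw [show emin E + 2 = emin E + 1 + 1 by ring, zpow_add_one₀ (by norm_num)]; ring
  have hpow' : (2 : ℝ) ^ (emin E + 1) = 2 * 2 ^ emin E := by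
    rw [zpow_add_one₀ (by norm_num)]; ring
  have hp : (0 : ℝ) < 2 ^ emin E := by positivity
  let c' : Fin𝔽 E M := ⟨c / 2, c.2.half (by linarith)⟩
  let half : Fin𝔽 E M := ⟨2 ^ (-1 : ℤ), .zpow h (by omega) (by omega)⟩
  have hhalf : (half : ℝ) = 1 / 2 := by change (2 : ℝ) ^ (-1 : ℤ) = _; norm_num
  choose f hf using fun x : Fin𝔽 E M =>
    exists_rnd_eq h (abs_mul_lt_overflow (c := half) (by rw [hhalf]; norm_num)
      (by rw [hhalf]; norm_num) x)
  have hΩpos : (2 : ℝ) ^ (emin E + 1) ≤ maxFloat E M := by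
    have := hc2.trans (abs_le_maxFloat c)
    linarith
  let Ω' : Fin𝔽 E M := ⟨maxFloat E M / 2, (isFinite_maxFloat h).half (by
    rwa [abs_of_pos (by linarith)])⟩
  have hΩ : (Ω' : ℝ) = maxFloat E M / 2 := rfl
  have hc' : (c' : ℝ) = c / 2 := rfl
  have hcΩ := abs_le.mp (abs_le_maxFloat c)
  have hbound : ∀ x, |(f x : ℝ) + (neg c' : Fin𝔽 E M)| < overflow E M := by
    intro x
    have hx := abs_le.mp (abs_le_maxFloat x)
    have h1 := le_of_rnd h (x := Ω') (hf x) (by rw [hhalf, hΩ]; linarith)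
    have h2 := ge_of_rnd h (x := neg Ω') (hf x) (by rw [hhalf, coe_neg, hΩ]; linarith)
    refine lt_of_le_of_lt (abs_le.mpr ?_) (maxFloat_lt_overflow (E := E) (M := M))
    rw [coe_neg, hΩ] at *
    rw [hc']
    constructor <;> linarith
  have hsub : ∀ y : Fin𝔽 E M, ∃ z : Fin𝔽 E M,
      |(y : ℝ) + (neg c' : Fin𝔽 E M)| < overflow E M →
        rnd E M ((y + (neg c' : Fin𝔽 E M) : ℝ) : EReal) = z.toExt := by
    intro y
    by_cases hy : |(y : ℝ) + (neg c' : Fin𝔽 E M)| < overflow E M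
    · obtain ⟨z, hz⟩ := exists_rnd_eq h hy
      exact ⟨z, fun _ => hz⟩
    · exact ⟨y, fun hc => absurd hc hy⟩
  choose k hk using hsub
  have hkf : ∀ x, rnd E M ((f x + (neg c' : Fin𝔽 E M) : ℝ) : EReal) = (k (f x)).toExt :=
    fun x => hk _ (hbound x)
  refine ⟨k ∘ f, ?_, fun x => ?_⟩
  · obtain ⟨F, hF⟩ := Realizes.mul_const (n := n) h half (by rw [hhalf]; norm_num) hf
    exact ⟨fun e => .add (F e) (.const (neg c')), fun e B x y hxy =>
      sharp_add_is h (hF _ _ _ _ hxy) (mk_self_is _) (hkf x) (hkf y)⟩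
  · rw [Function.comp_apply, nonneg_of_rnd_sub h (x := f x) (y := c')
      (by rw [sub_eq_add_neg]; exact hkf x)]
    change _ ↔ (c : ℝ) ≤ x
    constructor
    · contrapose!
      intro hxc
      -- It suffices to find a float in `[x / 2, c / 2)`.
      obtain ⟨d, hd1, hd2⟩ : ∃ d : Fin𝔽 E M, (x : ℝ) / 2 ≤ d ∧ (d : ℝ) < c / 2 := by
        rcases le_or_gt (2 ^ (emin E + 1)) |(x : ℝ)| with hx | hx
        · exact ⟨⟨_, x.2.half hx⟩, le_rfl, by simpa using by linarith⟩
        · refine ⟨⟨_, .zpow h (j := emin E) (by omega) (by omega)⟩, ?_, ?_⟩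
          · have := (abs_lt.mp hx).2
            simpa using by linarith
          · have := (abs_lt.mp hx).1
            have : (2 : ℝ) ^ (emin E + 2) ≤ c := by
              rcases le_abs.mp hc2 with h | h
              · exact h
              · linarith
            simpa using by linarith
      exact (le_of_rnd h (x := d) (hf x) (by rw [hhalf]; linarith)).trans_lt hd2
    · intro hcx
      exact ge_of_rnd h (x := c') (hf x) (by rw [hhalf, hc']; linarith)

/-- The threshold functions `x ↦ truth (c ≤ x)` can be applied exactly. -/
theorem realizes_threshold (h : Admissible E M) (c : Fin𝔽 E M) :
    Realizes n (fun x => truth h (c ≤ x)) := by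
  obtain ⟨g, hg, hgc⟩ := exists_realizes_nonneg_iff (n := n) h c
  choose k hk using fun x : Fin𝔽 E M => exists_rnd_eq h (add_lt_overflow (tiny_lt_zpow h) x)
  have ht := tiny_pos h
  have heq : (fun x => truth h (c ≤ x)) = sgn h ∘ k ∘ sgn h ∘ g := by
    funext x
    simp only [Function.comp_apply]
    rcases lt_trichotomy (g x : ℝ) 0 with hx | hx | hx
    · rw [truth_of_false h (by rw [← hgc]; exact hx.not_ge), sgn_of_neg h hx]
      refine (sgn_of_eq_zero h ?_).symm
      have : k (neg (tiny h)) = zero h := by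
        rw [← Fin𝔽.toExt_inj, ← hk]
        exact rnd_eq_of_eq h (by simp)
      rw [this, coe_zero]
    · rw [truth_of_true h ((hgc x).mp hx.ge), sgn_of_eq_zero h hx]
      refine (sgn_of_pos h ?_).symm
      exact ht.trans_le (ge_of_rnd h (hk _) (by simp))
    · rw [truth_of_true h ((hgc x).mp hx.le), sgn_of_pos h hx]
      refine (sgn_of_pos h ?_).symm
      exact ht.trans_le (ge_of_rnd h (hk _) (by linarith))
  rw [heq]
  exact (realizes_sgn h).comp ((Realizes.add_const h (tiny h) hk).comp ((realizes_sgn h).comp hg))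

/-! ### Truth values -/

/-- The abstract box `B` is the product of the intervals `⟨a i, b i⟩`. -/
def IsBox (B : Fin n → AbsInterval E M) (a b : Fin n → Fin𝔽 E M) : Prop :=
  ∀ i, (B i).Is (a i).toExt (b i).toExt

/-- Some expression evaluates, on each box `[a, b]`, to an interval whose end points are the truth
values of `L a b` and `U a b`. -/
def Decides (h : Admissible E M) (L U : (Fin n → Fin𝔽 E M) → (Fin n → Fin𝔽 E M) → Prop) : Prop :=
  ∃ e : Expr E M n, ∀ B a b, IsBox B a b →
    (e.ieval B).Is (truth h (L a b)).toExt (truth h (U a b)).toExt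

section

variable {h : Admissible E M} {L U L' U' : (Fin n → Fin𝔽 E M) → (Fin n → Fin𝔽 E M) → Prop}

theorem Decides.congr (hd : Decides h L U)
    (hL : ∀ a b, (∀ i, a i ≤ b i) → (L a b ↔ L' a b))
    (hU : ∀ a b, (∀ i, a i ≤ b i) → (U a b ↔ U' a b)) : Decides h L' U' := by
  obtain ⟨e, he⟩ := hd
  refine ⟨e, fun B a b hB => ?_⟩
  have hab : ∀ i, a i ≤ b i := fun i => Fin𝔽.toExt_le.mp (hB i).1
  rw [← propext (hL a b hab), ← propext (hU a b hab)]
  exact he B a b hB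

theorem decides_true : Decides h (fun (_ _ : Fin n → Fin𝔽 E M) => True) fun _ _ => True :=
  ⟨.const (tiny h), fun _ _ _ _ => by rw [truth_of_true h trivial]; exact mk_self_is _⟩

theorem decides_false : Decides h (fun (_ _ : Fin n → Fin𝔽 E M) => False) fun _ _ => False :=
  ⟨.const (zero h), fun _ _ _ _ => by rw [truth_of_false h _root_.id]; exact mk_self_is _⟩

theorem decides_le (c : Fin𝔽 E M) (i : Fin n) :
    Decides h (fun a _ => c ≤ a i) fun _ b => c ≤ b i := by
  obtain ⟨G, hG⟩ := realizes_threshold (n := n) h c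
  exact ⟨G (.var i), fun B a b hB => hG _ _ _ _ (hB i)⟩

theorem neg_le_neg_iff {x y : Fin𝔽 E M} : neg x ≤ neg y ↔ y ≤ x := by
  change -(x : ℝ) ≤ -y ↔ (y : ℝ) ≤ x
  exact _root_.neg_le_neg_iff

theorem decides_ge (d : Fin𝔽 E M) (i : Fin n) :
    Decides h (fun _ b => b i ≤ d) fun a _ => a i ≤ d := by
  obtain ⟨G, hG⟩ := realizes_threshold (n := n) h (neg d)
  have h1 : IsFinite E M (2 ^ (0 : ℤ)) := by
    have := h.emin_le
    have := emax_eq E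
    exact .zpow h (by omega) (by omega)
  refine ⟨G (.mul (.var i) (.const (neg ⟨_, h1⟩))), fun B a b hB => ?_⟩
  have := hG (.mul (.var i) (.const (neg ⟨_, h1⟩))) B _ _
    (sharp_mul_neg_one_is h (by simp) (hB i) (mk_self_is _))
  simpa only [neg_le_neg_iff] using this

/-- The sum of two truth values is `0`, `tiny` or `2 * tiny`, so that a threshold function of it is
the disjunction or the conjunction. -/
theorem exists_sum_truth (h : Admissible E M) : ∃ two : Fin𝔽 E M, ∀ s t : Prop,
    ∃ z : Fin𝔽 E M, rnd E M ((truth h s + truth h t : ℝ) : EReal) = z.toExt ∧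
      (tiny h ≤ z ↔ s ∨ t) ∧ (two ≤ z ↔ s ∧ t) := by
  have := h.emin_le
  have := emax_eq E
  have h2 : IsFinite E M (2 ^ (emin E - M + 1)) := .zpow h (by omega) (by omega)
  have ht := tiny_pos h
  have hz : (⟨_, h2⟩ : Fin𝔽 E M) = (2 * tiny h : ℝ) := by
    change (2 : ℝ) ^ (emin E - M + 1) = 2 * 2 ^ (emin E - M)
    rw [zpow_add_one₀ (by norm_num)]; ring
  generalize (⟨_, h2⟩ : Fin𝔽 E M) = two at hz
  refine ⟨two, fun s t => ?_⟩
  by_cases hs : s <;> by_cases hs' : t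
  · refine ⟨two, rnd_eq_of_eq h ?_, ?_⟩
    · rw [truth_of_true h hs, truth_of_true h hs', hz]; ring
    · simp only [hs, hs', ← Subtype.coe_le_coe, hz, or_true, and_true, iff_true]
      constructor <;> linarith
  · refine ⟨tiny h, rnd_eq_of_eq h ?_, ?_⟩
    · rw [truth_of_true h hs, truth_of_false h hs', coe_zero, add_zero]
    · simp only [hs, hs', ← Subtype.coe_le_coe, hz, or_false, and_false, iff_true, iff_false]
      constructor <;> linarith
  · refine ⟨tiny h, rnd_eq_of_eq h ?_, ?_⟩
    · rw [truth_of_false h hs, truth_of_true h hs', coe_zero, zero_add]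
    · simp only [hs, hs', ← Subtype.coe_le_coe, hz, or_true, and_true, iff_true, iff_false]
      constructor <;> linarith
  · refine ⟨zero h, rnd_eq_of_eq h ?_, ?_⟩
    · rw [truth_of_false h hs, truth_of_false h hs', coe_zero, add_zero]
    · simp only [hs, hs', ← Subtype.coe_le_coe, hz, coe_zero, or_self, and_self, iff_false]
      constructor <;> linarith

theorem Decides.or (hd : Decides h L U) (hd' : Decides h L' U') :
    Decides h (fun a b => L a b ∨ L' a b) fun a b => U a b ∨ U' a b := by
  obtain ⟨e, he⟩ := hd
  obtain ⟨e', he'⟩ := hd'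
  obtain ⟨two, htwo⟩ := exists_sum_truth h
  obtain ⟨G, hG⟩ := realizes_threshold (n := n) h (tiny h)
  refine ⟨G (.add e e'), fun B a b hB => ?_⟩
  obtain ⟨z, hz, hor, -⟩ := htwo (L a b) (L' a b)
  obtain ⟨w, hw, hor', -⟩ := htwo (U a b) (U' a b)
  have := hG (.add e e') B z w (sharp_add_is h (he B a b hB) (he' B a b hB) hz hw)
  simpa only [hor, hor'] using this

theorem Decides.and (hd : Decides h L U) (hd' : Decides h L' U') :
    Decides h (fun a b => L a b ∧ L' a b) fun a b => U a b ∧ U' a b := by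
  obtain ⟨e, he⟩ := hd
  obtain ⟨e', he'⟩ := hd'
  obtain ⟨two, htwo⟩ := exists_sum_truth h
  obtain ⟨G, hG⟩ := realizes_threshold (n := n) h two
  refine ⟨G (.add e e'), fun B a b hB => ?_⟩
  obtain ⟨z, hz, -, hand⟩ := htwo (L a b) (L' a b)
  obtain ⟨w, hw, -, hand'⟩ := htwo (U a b) (U' a b)
  have := hG (.add e e') B z w (sharp_add_is h (he B a b hB) (he' B a b hB) hz hw)
  simpa only [hand, hand'] using this

theorem Decides.exists_mem {ι : Type} (s : Finset ι)
    {L U : ι → (Fin n → Fin𝔽 E M) → (Fin n → Fin𝔽 E M) → Prop}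
    (hd : ∀ i ∈ s, Decides h (L i) (U i)) :
    Decides h (fun a b => ∃ i ∈ s, L i a b) fun a b => ∃ i ∈ s, U i a b := by
  classical
  induction s using Finset.induction_on with
  | empty => simpa using decides_false
  | insert i s _ ih =>
    have := (hd i (by simp)).or (ih fun j hj => hd j (by simp [hj]))
    simpa only [Finset.exists_mem_insert] using this

theorem Decides.forall_mem {ι : Type} (s : Finset ι)
    {L U : ι → (Fin n → Fin𝔽 E M) → (Fin n → Fin𝔽 E M) → Prop}
    (hd : ∀ i ∈ s, Decides h (L i) (U i)) :
    Decides h (fun a b => ∀ i ∈ s, L i a b) fun a b => ∀ i ∈ s, U i a b := by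
  classical
  induction s using Finset.induction_on with
  | empty => simpa using decides_true
  | insert i s _ ih =>
    have := (hd i (by simp)).and (ih fun j hj => hd j (by simp [hj]))
    simpa only [Finset.forall_mem_insert] using this

/-- The indicator function of a box `[c, d]`: on `[a, b]`, its minimum is true if `[a, b]`
is contained in `[c, d]`, and its maximum is true if the two boxes meet. -/
theorem decides_box (c d : Fin n → Fin𝔽 E M) :
    Decides h (fun a b => ∀ i, c i ≤ a i ∧ b i ≤ d i) fun a b => ∀ i, c i ≤ b i ∧ a i ≤ d i := by
  have := Decides.forall_mem (h := h) Finset.univ fun i _ =>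
    (decides_le (c i) i).and (decides_ge (d i) i)
  simpa only [Finset.mem_univ, true_imp_iff] using this

/-- The indicator function of an arbitrary set `S` has an exact interval evaluation: it is the
disjunction of the indicator functions of *all* boxes inside `S`, so that each box inside `S` is
covered by a single term. -/
theorem decides_set (h : Admissible E M) (S : Set (Fin n → Fin𝔽 E M)) :
    Decides h (fun a b => Set.Icc a b ⊆ S) fun a b => ∃ x ∈ Set.Icc a b, x ∈ S := by
  let T : Set ((Fin n → Fin𝔽 E M) × (Fin n → Fin𝔽 E M)) :=
    {p | p.1 ≤ p.2 ∧ Set.Icc p.1 p.2 ⊆ S}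
  have hT : T.Finite := Set.toFinite T
  refine (Decides.exists_mem (h := h) hT.toFinset fun p _ => decides_box p.1 p.2).congr
    (fun a b hab => ?_) (fun a b hab => ?_)
  · simp only [Set.Finite.mem_toFinset]
    constructor
    · rintro ⟨⟨c, d⟩, ⟨-, hcd⟩, hp⟩ x hx
      exact hcd ⟨fun i => (hp i).1.trans (hx.1 i), fun i => (hx.2 i).trans (hp i).2⟩
    · exact fun hS => ⟨(a, b), ⟨hab, hS⟩, fun i => ⟨le_rfl, le_rfl⟩⟩
  · simp only [Set.Finite.mem_toFinset]
    constructor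
    · rintro ⟨⟨c, d⟩, ⟨hle, hcd⟩, hp⟩
      refine ⟨a ⊔ c, ⟨le_sup_left, sup_le hab fun i => (hp i).1⟩, hcd ⟨le_sup_right, ?_⟩⟩
      exact sup_le (fun i => (hp i).2) hle
    · rintro ⟨x, hx, hxS⟩
      refine ⟨(x, x), ⟨le_rfl, ?_⟩, fun i => ⟨hx.2 i, hx.1 i⟩⟩
      rw [Set.Icc_self]
      exact Set.singleton_subset_iff.mpr hxS

end

/-! ### Prescribed output values -/

/-- The difference of two adjacent non-negative floats is a float. -/
theorem isFinite_sub_of_nonneg (h : Admissible E M) {y z : ℝ} (hy : IsFinite E M y)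
    (hz : IsFinite E M z) (h0 : 0 ≤ y) (hyz : y < z)
    (hadj : ∀ w, IsFinite E M w → w ≤ y ∨ z ≤ w) : IsFinite E M (z - y) := by
  obtain ⟨k, hk0, hk, he, hyk⟩ := canonical hy h0 h.two_le
  obtain ⟨l, hl0, hl, he', hzl⟩ := canonical hz (h0.trans hyz.le) h.two_le
  have hemin := emin_le_expo E y
  have hmono := expo_mono (E := E) h0 hyz.le
  set e := expo E y
  set e₂ := expo E z
  have hp : (0 : ℝ) < 2 ^ (e - M) := by positivity
  have hsub : z - y = ((l * 2 ^ (e₂ - e).toNat - k : ℤ) : ℝ) * (2 : ℝ) ^ (e - M) := by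
    push_cast
    rw [sub_mul, ← hyk, mul_assoc, ← zpow_natCast, ← zpow_add₀ (by norm_num),
      Int.toNat_of_nonneg (by omega), show e₂ - e + (e - M) = e₂ - M by ring, ← hzl]
  have hpow : ∀ e : ℤ, (2 : ℝ) ^ (e + 1) = 2 ^ (M + 1) * 2 ^ (e - M) := fun e => by
    rw [← zpow_natCast, ← zpow_add₀ (by norm_num)]
    congr 1; push_cast; ring
  generalize l * 2 ^ (e₂ - e).toNat - k = j at hsub
  have hj : 0 < j := by
    have : 0 < (j : ℝ) * 2 ^ (e - M) := by linarith
    exact_mod_cast (pos_iff_pos_of_mul_pos this).mpr hp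
  rcases lt_or_ge j (2 ^ (M + 1)) with hlt | hge
  · exact ⟨j, e, by rwa [abs_of_pos hj], hemin, he, hsub⟩
  -- If the gap exceeds the precision, then `2 ^ (e + 1)` is a float between `y` and `z`.
  have hgap : (2 : ℝ) ^ (e + 1) ≤ z - y := by
    rw [hsub, hpow]
    exact mul_le_mul_of_nonneg_right (by exact_mod_cast hge) hp.le
  have hy' : y < 2 ^ (e + 1) := by
    rw [hyk, hpow]
    exact mul_lt_mul_of_pos_right (by exact_mod_cast hk) hp
  have hz' : z < 2 ^ (e₂ + 1) := by
    rw [hzl, hpow]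
    exact mul_lt_mul_of_pos_right (by exact_mod_cast hl) (by positivity)
  have he2 : e + 1 < e₂ + 1 :=
    (zpow_lt_zpow_iff_right₀ (by norm_num : (1 : ℝ) < 2)).mp (by linarith)
  have hle := (hadj _ (.zpow h (j := e + 1) (by omega) (by omega))).resolve_left hy'.not_ge
  rw [show z - y = z by linarith]
  exact hz

/-- The difference of two adjacent floats is a float. -/
theorem isFinite_sub (h : Admissible E M) {y z : ℝ} (hy : IsFinite E M y)
    (hz : IsFinite E M z) (hyz : y < z)
    (hadj : ∀ w, IsFinite E M w → w ≤ y ∨ z ≤ w) : IsFinite E M (z - y) := by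
  rcases le_or_gt 0 y with h0 | h0
  · exact isFinite_sub_of_nonneg h hy hz h0 hyz hadj
  · have hz0 : z ≤ 0 := (hadj 0 (isFinite_zero h.two_le)).resolve_left h0.not_ge
    have := isFinite_sub_of_nonneg h (isFinite_neg hz) (isFinite_neg hy) (by linarith)
      (neg_lt_neg hyz) fun w hw => by
        rcases hadj (-w) (isFinite_neg hw) with h | h
        · right; linarith
        · left; linarith
    rwa [neg_sub_neg] at this

/-- Some expression evaluates, on each box `[a, b]`, to the interval `⟨p a b, q a b⟩`. -/
def Computes (p q : (Fin n → Fin𝔽 E M) → (Fin n → Fin𝔽 E M) → Ext𝔽 E M) : Prop :=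
  ∃ e : Expr E M n, ∀ B a b, IsBox B a b → (e.ieval B).Is (p a b) (q a b)

theorem Decides.computes_select {h : Admissible E M}
    {L U : (Fin n → Fin𝔽 E M) → (Fin n → Fin𝔽 E M) → Prop} (hd : Decides h L U) {x : Fin𝔽 E M}
    (hx : (0 : ℝ) ≤ x) :
    Computes (fun a b => (select h (L a b) x).toExt) fun a b => (select h (U a b) x).toExt := by
  have step : ∀ {y z c : Fin𝔽 E M}, (0 : ℝ) ≤ c → (z : ℝ) = y * c →
      Computes (fun a b => (select h (L a b) y).toExt) (fun a b => (select h (U a b) y).toExt) →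
      Computes (fun a b => (select h (L a b) z).toExt) fun a b => (select h (U a b) z).toExt := by
    rintro y z c hc hz ⟨e, he⟩
    have key : ∀ s : Prop, rnd E M ((select h s y * c : ℝ) : EReal) = (select h s z).toExt := by
      intro s
      refine rnd_eq_of_eq h ?_
      by_cases hs : s
      · rw [select_of_true h hs, select_of_true h hs, hz]
      · rw [select_of_false h hs, select_of_false h hs, coe_zero, zero_mul]
    exact ⟨.mul e (.const c), fun B a b hB =>
      sharp_mul_is h hc (he B a b hB) (mk_self_is _) (key _) (key _)⟩
  have hmin := h.emin_le
  have hM := h.le_emax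
  have hmm := emax_eq E
  have h3 := h.three_le
  -- The quotient `1 / tiny` overflows, but it is a product of two floats.
  let c₁ : Fin𝔽 E M := ⟨2 ^ emax E, .zpow h (by omega) le_rfl⟩
  let c₂ : Fin𝔽 E M := ⟨2 ^ ((M : ℤ) - 1), .zpow h (by omega) (by omega)⟩
  let y₁ : Fin𝔽 E M := ⟨2 ^ (1 - (M : ℤ)), .zpow h (by omega) (by omega)⟩
  let one : Fin𝔽 E M := ⟨2 ^ (0 : ℤ), .zpow h (by omega) (by omega)⟩
  refine step hx (y := one) (by simp [one]) (step (c := c₂) (y := y₁) ?_ ?_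
    (step (c := c₁) (y := tiny h) ?_ ?_ hd))
  · change (0 : ℝ) ≤ 2 ^ ((M : ℤ) - 1); positivity
  · change (2 : ℝ) ^ (0 : ℤ) = 2 ^ (1 - (M : ℤ)) * 2 ^ ((M : ℤ) - 1)
    rw [← zpow_add₀ (by norm_num)]
    congr 1; ring
  · change (0 : ℝ) ≤ 2 ^ emax E; positivity
  · change (2 : ℝ) ^ (1 - (M : ℤ)) = 2 ^ (emin E - M) * 2 ^ emax E
    rw [← zpow_add₀ (by norm_num)]
    congr 1; omega

theorem Computes.add_select {h : Admissible E M}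
    {p q p' q' : (Fin n → Fin𝔽 E M) → (Fin n → Fin𝔽 E M) → Ext𝔽 E M}
    {L U : (Fin n → Fin𝔽 E M) → (Fin n → Fin𝔽 E M) → Prop} {x : Fin𝔽 E M}
    (hc : Computes p q) (hd : Decides h L U) (hx : (0 : ℝ) ≤ x)
    (hp : ∀ a b, rnd E M (Ext𝔽.toEReal (p a b) + (select h (L a b) x : ℝ)) = p' a b)
    (hq : ∀ a b, rnd E M (Ext𝔽.toEReal (q a b) + (select h (U a b) x : ℝ)) = q' a b) :
    Computes p' q' := by
  obtain ⟨e, he⟩ := hc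
  obtain ⟨f, hf⟩ := hd.computes_select hx
  exact ⟨.add e f, fun B a b hB => sharp_add_is h (he B a b hB) (hf B a b hB) (hp a b) (hq a b)⟩

theorem Computes.add_const (h : Admissible E M)
    {p q p' q' : (Fin n → Fin𝔽 E M) → (Fin n → Fin𝔽 E M) → Ext𝔽 E M} (c : Fin𝔽 E M)
    (hc : Computes p q) (hp : ∀ a b, rnd E M (Ext𝔽.toEReal (p a b) + (c : ℝ)) = p' a b)
    (hq : ∀ a b, rnd E M (Ext𝔽.toEReal (q a b) + (c : ℝ)) = q' a b) : Computes p' q' := by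
  obtain ⟨e, he⟩ := hc
  exact ⟨.add e (.const c), fun B a b hB =>
    sharp_add_is h (he B a b hB) (mk_self_is _) (hp a b) (hq a b)⟩

theorem rnd_of_le {x : EReal} (hx : x ≤ ((-overflow E M : ℝ) : EReal)) : rnd E M x = ⊥ := if_pos hx

theorem rnd_of_ge (h : Admissible E M) {x : EReal} (hx : ((overflow E M : ℝ) : EReal) ≤ x) :
    rnd E M x = ⊤ := by
  have hpos : 0 < overflow E M :=
    ((abs_nonneg _).trans (abs_le_maxFloat (zero h))).trans_lt maxFloat_lt_overflow
  rw [rnd, if_neg, if_pos hx]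
  refine not_le.mpr (lt_of_lt_of_le ?_ hx)
  rw [EReal.coe_lt_coe_iff]
  linarith

theorem rnd_toEReal (h : Admissible E M) (v : Ext𝔽 E M) : rnd E M (Ext𝔽.toEReal v) = v := by
  induction v using WithBot.recBotCoe with
  | bot => exact rnd_of_le bot_le
  | coe v =>
    induction v using WithTop.recTopCoe with
    | top => exact rnd_of_ge h le_top
    | coe v => exact rnd_coe h v

/-- The largest finite float. -/
noncomputable def largest (h : Admissible E M) : Fin𝔽 E M := ⟨maxFloat E M, isFinite_maxFloat h⟩

theorem overflow_le (h : Admissible E M) : overflow E M ≤ largest h + largest h := by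
  have := h.emin_le
  have := emax_eq E
  have := h.le_emax
  have := abs_le_maxFloat (⟨_, .zpow h (j := emax E - M - 1) (by omega) (by omega)⟩ : Fin𝔽 E M)
  have := (le_abs_self _).trans this
  rw [overflow_eq]
  exact add_le_add_right this _

theorem le_largest (h : Admissible E M) (x : Fin𝔽 E M) : x ≤ largest h :=
  (le_abs_self (x : ℝ)).trans (abs_le_maxFloat x)

theorem neg_largest_le (h : Admissible E M) (x : Fin𝔽 E M) : neg (largest h) ≤ x :=
  (abs_le.mp (abs_le_maxFloat x)).1

/-- If the comparisons of `p` and `q` with every threshold `w` are decided, then `⟨p, q⟩` is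
computed: for adjacent floats `u < v`, `min p v` is the sum of `min p u` and, where `v ≤ p`, of
`v - u`. These sums are exact. -/
theorem computes_of_decides (h : Admissible E M)
    {p q : (Fin n → Fin𝔽 E M) → (Fin n → Fin𝔽 E M) → Ext𝔽 E M}
    (hd : ∀ w : Ext𝔽 E M, Decides h (fun a b => w ≤ p a b) fun a b => w ≤ q a b) :
    Computes p q := by
  have hΩ : (0 : ℝ) ≤ largest h := le_largest h (zero h)
  have hmin : ∀ v : Fin𝔽 E M,
      Computes (fun a b => min (p a b) v.toExt) fun a b => min (q a b) v.toExt := by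
    intro v
    induction v using WellFoundedLT.induction with
    | ind v ih =>
    rcases (neg_largest_le h v).eq_or_lt with rfl | hv
    · -- The two values `-∞` and `-Ω` arise as the rounded sums `(0 - Ω) - Ω` and `(Ω - Ω) - Ω`.
      have key₁ : ∀ r : Ext𝔽 E M,
          rnd E M (Ext𝔽.toEReal (select h ((neg (largest h)).toExt ≤ r) (largest h)).toExt +
            (neg (largest h) : ℝ)) =
          (select h (¬ (neg (largest h)).toExt ≤ r) (neg (largest h))).toExt := by
        intro r
        rw [Fin𝔽.toEReal_toExt, ← EReal.coe_add]
        refine rnd_eq_of_eq h ?_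
        by_cases hr : (neg (largest h)).toExt ≤ r
        · rw [select_of_true h hr, select_of_false h (not_not_intro hr)]; simp
        · rw [select_of_false h hr, select_of_true h hr]; simp
      have key₂ : ∀ r : Ext𝔽 E M,
          rnd E M (Ext𝔽.toEReal (select h (¬ (neg (largest h)).toExt ≤ r)
            (neg (largest h))).toExt + (neg (largest h) : ℝ)) =
          min r (neg (largest h)).toExt := by
        intro r
        rw [Fin𝔽.toEReal_toExt, ← EReal.coe_add]
        by_cases hr : (neg (largest h)).toExt ≤ r
        · rw [select_of_false h (not_not_intro hr), min_eq_right hr]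
          exact rnd_eq_of_eq h (by simp)
        · rw [select_of_true h hr, min_eq_left (not_le.mp hr).le, rnd_of_le]
          · induction r using WithBot.recBotCoe with
            | bot => rfl
            | coe r =>
              induction r using WithTop.recTopCoe with
              | top => exact absurd le_top hr
              | coe r => exact absurd (Fin𝔽.toExt_le.mpr (neg_largest_le h r)) hr
          · rw [EReal.coe_le_coe_iff, coe_neg]
            linarith [overflow_le h]
      exact (((hd _).computes_select hΩ).add_const h _ (fun _ _ => key₁ _)
        (fun _ _ => key₁ _)).add_const h _ (fun _ _ => key₂ _) (fun _ _ => key₂ _)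
    · obtain ⟨u, huv, hu⟩ := (Set.toFinite (Set.Iio v)).exists_maximal ⟨_, hv⟩
      have hadj : ∀ w : Fin𝔽 E M, w < v → w ≤ u := fun w hw =>
        (le_total w u).elim _root_.id (hu hw)
      have huv' : (u : ℝ) < v := huv
      have hδ : IsFinite E M (v - u) := isFinite_sub h u.2 v.2 huv' fun w hw =>
        (lt_or_ge w (v : ℝ)).imp_left fun hlt => hadj ⟨w, hw⟩ hlt
      have key : ∀ r : Ext𝔽 E M, rnd E M (Ext𝔽.toEReal (min r u.toExt) +
          (select h (v.toExt ≤ r) ⟨_, hδ⟩ : ℝ)) = min r v.toExt := by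
        intro r
        by_cases hr : v.toExt ≤ r
        · rw [select_of_true h hr, min_eq_right hr,
            min_eq_right ((Fin𝔽.toExt_le.mpr huv'.le).trans hr), Fin𝔽.toEReal_toExt,
            ← EReal.coe_add]
          exact rnd_eq_of_eq h (by simp)
        · have hru : r ≤ u.toExt := by
            induction r using WithBot.recBotCoe with
            | bot => exact bot_le
            | coe r =>
              induction r using WithTop.recTopCoe with
              | top => exact absurd le_top hr
              | coe r =>
                exact Fin𝔽.toExt_le.mpr (hadj r (lt_of_not_ge fun hc => hr (Fin𝔽.toExt_le.mpr hc)))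
          rw [select_of_false h hr, min_eq_left hru, min_eq_left (not_le.mp hr).le, coe_zero,
            EReal.coe_zero, add_zero, rnd_toEReal h]
      exact (ih u huv).add_select (hd v.toExt) (sub_nonneg.mpr huv'.le) (fun _ _ => key _)
        (fun _ _ => key _)
  have key : ∀ r : Ext𝔽 E M, rnd E M (Ext𝔽.toEReal (min r (largest h).toExt) +
      (select h (⊤ ≤ r) (largest h) : ℝ)) = r := by
    intro r
    by_cases hr : ⊤ ≤ r
    · obtain rfl := top_le_iff.mp hr
      rw [select_of_true h hr, min_eq_right le_top, Fin𝔽.toEReal_toExt, ← EReal.coe_add]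
      exact rnd_of_ge h (EReal.coe_le_coe_iff.mpr (overflow_le h))
    · have hrΩ : r ≤ (largest h).toExt := by
        induction r using WithBot.recBotCoe with
        | bot => exact bot_le
        | coe r =>
          induction r using WithTop.recTopCoe with
          | top => exact absurd le_rfl hr
          | coe r => exact Fin𝔽.toExt_le.mpr (le_largest h r)
      rw [select_of_false h hr, min_eq_left hrΩ, coe_zero, EReal.coe_zero, add_zero, rnd_toEReal h]
  exact (hmin (largest h)).add_select (hd ⊤) hΩ (fun _ _ => key _) (fun _ _ => key _)

/-! ### From expressions to straight-line programs -/

/-- Register `r` of the code `p` holds the value of the expression `e`, over every domain. -/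
def Code.Holds {k : ℕ} (p : Code E M n k) (r : Fin k) (e : Expr E M n) : Prop :=
  ∀ {α : Type} (cst : Fin𝔽 E M → α) (add mul : α → α → α) (x : Fin n → α),
    p.run cst add mul x r = e.eval cst add mul x

theorem Code.Holds.castSucc {k : ℕ} {p : Code E M n k} {r : Fin k} {e : Expr E M n}
    (hp : p.Holds r e) (i : Instr E M k) : (p.snoc i).Holds r.castSucc e := by
  intro α cst add mul x
  rw [Code.run, Fin.snoc_castSucc]
  exact hp cst add mul x

/-- Each code can be extended so that some register holds a given expression, while all expressions
that it holds are retained. -/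
theorem Code.exists_extension (e : Expr E M n) {k : ℕ} (p : Code E M n k)
    (hp : ∀ i, ∃ r, p.Holds r (.var i)) :
    ∃ (k' : ℕ) (p' : Code E M n k'), (∃ r, p'.Holds r e) ∧
      ∀ f, (∃ r, p.Holds r f) → ∃ r, p'.Holds r f := by
  induction e generalizing k p with
  | var i => exact ⟨k, p, hp i, fun _ hf => hf⟩
  | const c =>
    refine ⟨_, p.snoc (.const c), ⟨Fin.last k, fun cst add mul x => ?_⟩,
      fun f ⟨r, hr⟩ => ⟨_, hr.castSucc _⟩⟩
    rw [Code.run, Fin.snoc_last]; rfl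
  | add e₁ e₂ ih₁ ih₂ =>
    obtain ⟨k₁, p₁, h₁, hp₁⟩ := ih₁ p hp
    obtain ⟨k₂, p₂, ⟨r₂, h₂⟩, hp₂⟩ := ih₂ p₁ fun i => hp₁ _ (hp i)
    obtain ⟨r₁, h₁⟩ := hp₂ _ h₁
    refine ⟨_, p₂.snoc (.add r₁ r₂), ⟨Fin.last k₂, fun cst add mul x => ?_⟩, fun f hf => ?_⟩
    · rw [Code.run, Fin.snoc_last, Instr.exec, h₁, h₂]; rfl
    · obtain ⟨r, hr⟩ := hp₂ _ (hp₁ _ hf)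
      exact ⟨_, hr.castSucc _⟩
  | mul e₁ e₂ ih₁ ih₂ =>
    obtain ⟨k₁, p₁, h₁, hp₁⟩ := ih₁ p hp
    obtain ⟨k₂, p₂, ⟨r₂, h₂⟩, hp₂⟩ := ih₂ p₁ fun i => hp₁ _ (hp i)
    obtain ⟨r₁, h₁⟩ := hp₂ _ h₁
    refine ⟨_, p₂.snoc (.mul r₁ r₂), ⟨Fin.last k₂, fun cst add mul x => ?_⟩, fun f hf => ?_⟩
    · rw [Code.run, Fin.snoc_last, Instr.exec, h₁, h₂]; rfl
    · obtain ⟨r, hr⟩ := hp₂ _ (hp₁ _ hf)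
      exact ⟨_, hr.castSucc _⟩

theorem Code.exists_holds {m : ℕ} (e : Fin m → Expr E M n) :
    ∃ (k : ℕ) (p : Code E M n k), (∀ i, ∃ r, p.Holds r (.var i)) ∧ ∀ j, ∃ r, p.Holds r (e j) := by
  induction m with
  | zero => exact ⟨n, .nil, fun i => ⟨i, fun _ _ _ _ => rfl⟩, fun j => j.elim0⟩
  | succ m ih =>
    obtain ⟨k, p, hp, he⟩ := ih fun j => e j.succ
    obtain ⟨k', p', h0, hp'⟩ := p.exists_extension (e 0) hp
    exact ⟨k', p', fun i => hp' _ (hp i), Fin.cases h0 fun j => hp' _ (he j)⟩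

theorem exists_prog {m : ℕ} (e : Fin m → Expr E M n) :
    ∃ Q : Prog E M n m, ∀ B j, Q.intervalEval B j = (e j).ieval B := by
  obtain ⟨k, p, -, hp⟩ := Code.exists_holds e
  choose out hout using hp
  exact ⟨⟨k, p, out⟩, fun B j => hout j _ _ _ B⟩

/-! ### Soundness of the interval semantics -/

theorem subset_conc_hull (S : Set (Float𝔽 E M)) : S ⊆ (hull S).conc := by
  intro y hy
  unfold hull
  split_ifs with hS
  · cases y with
    | nan => exact absurd hy hS.1
    | num v =>
      have hspec := Classical.choose_spec hS.2
      exact ⟨v, rfl, hspec.1.2 hy, hspec.2.2 hy⟩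
  · exact Set.mem_univ y

theorem Code.run_mem_conc {k : ℕ} (p : Code E M n k) {x : Fin n → Float𝔽 E M}
    {B : Fin n → AbsInterval E M} (hx : x ∈ boxConc B) (r : Fin k) :
    p.run Fin𝔽.toFloat Float𝔽.add Float𝔽.mul x r ∈
      (p.run (fun c => AbsInterval.mk c.toExt c.toExt le_rfl) (sharp Float𝔽.add)
        (sharp Float𝔽.mul) B r).conc := by
  induction p with
  | nil => exact hx r
  | snoc p i ih =>
    simp only [Code.run]
    refine Fin.lastCases ?_ (fun r => ?_) r
    · simp only [Fin.snoc_last]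
      cases i with
      | const c => exact ⟨_, rfl, le_rfl, le_rfl⟩
      | add i j => exact subset_conc_hull _ ⟨_, ih i, _, ih j, rfl⟩
      | mul i j => exact subset_conc_hull _ ⟨_, ih i, _, ih j, rfl⟩
    · simp only [Fin.snoc_castSucc]
      exact ih r

theorem Prog.eval_mem {m : ℕ} (Q : Prog E M n m) {x : Fin n → Float𝔽 E M}
    {B : Fin n → AbsInterval E M} (hx : x ∈ boxConc B) :
    Q.eval x ∈ boxConc (Q.intervalEval B) :=
  fun j => Q.code.run_mem_conc hx (Q.out j)

/-! ### Boxes of finite floats -/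

theorem AbsInterval.conc_nonempty (I : AbsInterval E M) : I.conc.Nonempty := by
  cases I with
  | mk a b h => exact ⟨_, a, rfl, le_rfl, h⟩
  | top => exact ⟨.nan, trivial⟩

theorem BoxFinite.exists_isBox {B : Fin n → AbsInterval E M} (hB : BoxFinite B) :
    ∃ a b, IsBox B a b := by
  choose y hy using fun i => (B i).conc_nonempty
  have hfin : ∀ i, ∀ z ∈ (B i).conc, ∃ x : Fin𝔽 E M, z = x.toFloat := by
    intro i z hz
    obtain ⟨x, hx⟩ := hB (a := Function.update y i z) fun j => by
      rcases eq_or_ne j i with rfl | hj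
      · simpa using hz
      · simpa [hj] using hy j
    exact ⟨x i, by simpa using congrFun hx i⟩
  have : ∀ i, ∃ a b : Fin𝔽 E M, (B i).Is a.toExt b.toExt := by
    intro i
    specialize hfin i
    cases hBi : B i with
    | top =>
      obtain ⟨x, hx⟩ := hfin .nan (by rw [hBi]; trivial)
      cases hx
    | mk p q hpq =>
      obtain ⟨a, ha⟩ := hfin (.num p) (by rw [hBi]; exact ⟨_, rfl, le_rfl, hpq⟩)
      obtain ⟨b, hb⟩ := hfin (.num q) (by rw [hBi]; exact ⟨_, rfl, hpq, le_rfl⟩)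
      cases ha
      cases hb
      exact ⟨a, b, hpq, rfl⟩
  choose a b hab using this
  exact ⟨a, b, hab⟩

theorem IsBox.mem_iff {B : Fin n → AbsInterval E M} {a b : Fin n → Fin𝔽 E M} (hB : IsBox B a b)
    (x : Fin n → Fin𝔽 E M) : (fun i => (x i).toFloat) ∈ boxConc B ↔ x ∈ Set.Icc a b := by
  have : ∀ i, (x i).toFloat ∈ (B i).conc ↔ a i ≤ x i ∧ x i ≤ b i := by
    intro i
    obtain ⟨h, hBi⟩ := hB i
    rw [hBi]
    constructor
    · rintro ⟨v, hv, h1, h2⟩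
      cases hv
      exact ⟨Fin𝔽.toExt_le.mp h1, Fin𝔽.toExt_le.mp h2⟩
    · exact fun h => ⟨_, rfl, Fin𝔽.toExt_le.mpr h.1, Fin𝔽.toExt_le.mpr h.2⟩
  exact (forall_congr' this).trans forall_and

theorem IntervalSimulates.nanFree {m : ℕ} {Q : Prog E M n m}
    {P : (Fin n → Fin𝔽 E M) → (Fin m → Ext𝔽 E M)} (hQ : IntervalSimulates Q P) : Q.NaNFree := by
  intro x j hnan
  let B : Fin n → AbsInterval E M := fun i => .mk (x i).toExt (x i).toExt le_rfl
  have hB : BoxFinite B := by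
    refine fun y hy => ⟨x, funext fun i => ?_⟩
    obtain ⟨v, hv, h1, h2⟩ := hy i
    rw [hv, le_antisymm h2 h1]
    rfl
  obtain ⟨lo, hi, -, -, heq⟩ := hQ B hB
  have := Q.eval_mem (B := B) (x := fun i => (x i).toFloat) fun i => ⟨_, rfl, le_rfl, le_rfl⟩
  rw [heq] at this
  obtain ⟨v, hv, -⟩ := this j
  rw [hnan] at hv
  cases hv

/-- On each box `[a, b]`, the exact range of `P` can be computed. -/
theorem exists_computes (h : Admissible E M) (P : (Fin n → Fin𝔽 E M) → Ext𝔽 E M) :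
    ∃ p q : (Fin n → Fin𝔽 E M) → (Fin n → Fin𝔽 E M) → Ext𝔽 E M, Computes p q ∧
      ∀ a b, (∀ i, a i ≤ b i) →
        IsLeast (P '' Set.Icc a b) (p a b) ∧ IsGreatest (P '' Set.Icc a b) (q a b) := by
  have hex : ∀ a b : Fin n → Fin𝔽 E M, ∃ r : Ext𝔽 E M × Ext𝔽 E M, (∀ i, a i ≤ b i) →
      IsLeast (P '' Set.Icc a b) r.1 ∧ IsGreatest (P '' Set.Icc a b) r.2 := by
    intro a b
    by_cases hab : ∀ i, a i ≤ b i
    · obtain ⟨r, hr⟩ := exists_min_max (P '' Set.Icc a b) ⟨_, a, ⟨le_rfl, hab⟩, rfl⟩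
      exact ⟨r, fun _ => hr⟩
    · exact ⟨(⊥, ⊥), fun hc => absurd hc hab⟩
  choose r hr using hex
  refine ⟨fun a b => (r a b).1, fun a b => (r a b).2, computes_of_decides h fun w =>
    (decides_set h {x | w ≤ P x}).congr (fun a b hab => ?_) (fun a b hab => ?_), hr⟩
  · obtain ⟨⟨x, hx, hxr⟩, hmin⟩ := (hr a b hab).1
    constructor
    · intro hS
      rw [← hxr]
      exact hS hx
    · exact fun hw y hy => hw.trans (hmin ⟨y, hy, rfl⟩)
  · obtain ⟨⟨x, hx, hxr⟩, hmax⟩ := (hr a b hab).2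
    constructor
    · rintro ⟨y, hy, hw⟩
      exact le_trans hw (hmax ⟨y, hy, rfl⟩)
    · exact fun hw => ⟨x, hx, hw.trans_eq hxr.symm⟩

theorem exists_intervalSimulates (h : Admissible E M) {m : ℕ}
    (P : (Fin n → Fin𝔽 E M) → (Fin m → Ext𝔽 E M)) :
    ∃ Q : Prog E M n m, IntervalSimulates Q P := by
  choose p q hpq hr using fun j : Fin m => exists_computes h fun x => P x j
  choose e he using hpq
  obtain ⟨Q, hQ⟩ := exists_prog e
  refine ⟨Q, fun B hB => ?_⟩
  obtain ⟨a, b, hab⟩ := hB.exists_isBox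
  have hle : ∀ i, a i ≤ b i := fun i => Fin𝔽.toExt_le.mp (hab i).1
  have himage : ∀ j, imageOn P B j = (fun x => P x j) '' Set.Icc a b := fun j => by
    ext v
    simp only [imageOn, hab.mem_iff, Set.mem_ofPred_eq, Set.mem_image]
  refine ⟨fun j => p j a b, fun j => q j a b, fun j => ?_, fun j => ?_, ?_⟩
  · rw [himage]; exact (hr j a b hle).1
  · rw [himage]; exact (hr j a b hle).2
  · refine Set.ext fun y => forall_congr' fun j => ?_
    obtain ⟨_, hj⟩ := he j B a b hab
    rw [hQ, hj]
    rfl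

end FloatIA

theorem theorem3 (E M : ℕ) (hE : 5 ≤ E) (hM : 3 ≤ M) (hME : M ≤ 2 ^ (E - 1))
    (n m : ℕ) (hn : 1 ≤ n) (hm : 1 ≤ m)
    (P : (Fin n → FloatIA.Fin𝔽 E M) → (Fin m → FloatIA.Ext𝔽 E M)) :
    ∃ Q : FloatIA.Prog E M n m, Q.NaNFree ∧ FloatIA.IntervalSimulates Q P := by
  obtain ⟨Q, hQ⟩ := FloatIA.exists_intervalSimulates ⟨hE, hM, hME⟩ P
  exact ⟨Q, hQ.nanFree, hQ⟩
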